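/- **Model.** There are $n$ processes $p_1,\dots,p_n$, at most $t<n/3$ of which are Byzantine (they may send arbitrary messages at any time, but cannot impersonate other processes). Every message sent by a non-faulty process to a non-faulty process is received, unmodified, after a finite time, and no message is created by the network. Each non-faulty process $p_i$ starts the algorithm at some finite time with an input $v_i\in\{0,1\}$ (the value it *proposes*), executes every step it can execute after a finite time, and its timers expire after a finite time. Only finitely many events take place in a bounded time. The assumption $\Diamond Synch$ says that in each execution there are a finite time $\tau$ and bounds $\delta\ge0$, $\theta\ge0$, $c\ge1$, all unknown to the processes, such that every message sent between non-faulty processes after $\tau$ is received within $\delta$ time units; after $\tau$, every non-faulty process that has started executes an executable step within $\theta$ time units; and a timer set to $T$ by a non-faulty process after $\tau$, if it is not abandoned, expires at least $T/c$ and at most $cT$ time units later. **Algorithm** (for non-faulty $p_i$; "broadcast" means "send to all processes, including oneself"). Initially $est_i=v_i$, $r_i=0$, $timeout_i=0$, all sets $bin\_values_i[r]$ are empty. Then $p_i$ repeats forever: 1. $r_i\leftarrow r_i+1$; broadcast $B\_VAL[r_i](est_i)$. 2. (New1) Wait until the *start condition* holds; $timeout_i\leftarrow timeout_i+1$; set the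 timer to $timeout_i$. 3. (New2) If $i=((r_i-1)\bmod n)+1$ (that is, $p_i$ is the weak coordinator of round $r_i$), wait until $bin\_values_i[r_i]\ne\emptyset$ and broadcast $COORD\_VALUE[r_i](w)$, where $w$ is the first value that entered $bin\_values_i[r_i]$. 4. Wait until $bin\_values_i[r_i]\neq\emptyset$ and the timer has expired. If some message $COORD\_VALUE[r_i](w)$ with $w\in bin\_values_i[r_i]$ was received from the coordinator of round $r_i$, then $aux_i\leftarrow\{w\}$ for such a $w$, else $aux_i\leftarrow bin\_values_i[r_i]$. Broadcast $AUX[r_i](aux_i)$. 5. (New4) Wait until $AUX[r_i]$ messages were received from $n-t$ different processes; set the timer to $timeout_i$. 6. Wait until the timer has expired and there is a non-empty set $V\subseteq bin\_values_i[r_i]$ that is the union of the contents of $AUX[r_i]$ messages received from $n-t$ different processes. Let $values_i$ be such a set $V$, namely $values_i=aux_i$ if $aux_i$ is one of them. 7. If $values_i=\{v\}$ is a singleton, then $est_i\leftarrow v$, and if moreover $v=r_i\bmod 2$, decide $v$ unless a decision was already made; otherwise $est_i\leftarrow r_i\bmod 2$. Concurrently, for all $r\ge1$ and $v\in\{0,1\}$: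 when $B\_VAL[r](v)$ has been received from $t+1$ different processes and $p_i$ has not yet broadcast it, $p_i$ broadcasts it; when it has been received from $2t+1$ different processes, $v$ is added to $bin\_values_i[r]$. *Catch-up.* Steps 1-4 of round $r$ form the mini-round $2r$, to which the messages $B\_VAL[r]$ and $COORD\_VALUE[r]$ belong, and steps 5-7 form the mini-round $2r+1$, to which the messages $AUX[r]$ belong. If a process in mini-round $\rho$ has received messages of one mini-round $\rho'>\rho$ from $t+1$ different processes, then it no longer waits for timers in the mini-rounds $\rho,\dots,\rho'-1$ (all the other waiting conditions stay in force). The start condition in step 2 is either "$B\_VAL[r_i]$ messages (with any value) were received from $n-t$ different processes" or "$bin\_values_i[r_i]\ne\emptyset$" (the same one at all processes and in all rounds). The timeout value grows either by 1 in each round, as written above, or by 1 in each mini-round (then step 5 also executes $timeout_i\leftarrow timeout_i+1$ before it sets the timer). **Theorem.** With either start condition and either growth of the timeouts, the algorithm solves binary Byzantine consensus under $t<n/3$ and $\Diamond Synch$; that is, every execution satisfies - *BBC-Validity*: every value decided by a non-faulty process was proposed by a non-faulty process; - *BBC-Agreement*: no two non-faulty processes decide different values; - *BBC-Termination*: every non-faulty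 process decides. -/

import Mathlib

/-!
The binary Byzantine consensus algorithm with weak round coordinators, growing timers and the
catch-up mechanism, as an operational model: `n` processes `Fin n`, up to `t` of them Byzantine,
exchanging messages over reliable point-to-point channels.  Binary values are Booleans, with `true`
for `1` and `false` for `0`.
-/

namespace BBC

/-- Messages.  `est r v` is the message `B_VAL(v)` of the BV-broadcast instance `EST[r]`;
`coord r w` is `COORD_VALUE[r](w)`; `aux r S` is `AUX[r](S)`. -/
inductive Msg where
  | est (r : ℕ) (v : Bool)
  | coord (r : ℕ) (w : Bool)
  | aux (r : ℕ) (S : Finset Bool)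

/-- The mini-round a message belongs to: round `r` is made up of the mini-rounds `2r` (up to the
expiration of the first timer) and `2r + 1` (the rest of the round). -/
def Msg.miniRound : Msg → ℕ
  | .est r _ => 2 * r
  | .coord r _ => 2 * r
  | .aux r _ => 2 * r + 1

/-- Program counter: the line a process is about to execute.  `idle` means that the process has not
yet invoked `bin_propose`; the others are the lines New1, New2, M-05, New4, M-07. -/
inductive PC where
  | idle
  | new1
  | new2
  | m05
  | new4
  | m07

/-- State of the local timer: not in use, running (with the instant at which it was set and the
number of local time units it was set to), or expired. -/
inductive Timer where
  | off
  | running (since : ℝ) (duration : ℕ)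
  | expired

/-- The condition that a process waits for at line New1, before it starts the first timer of a
round: either `EST[r]` messages from `n - t` different processes, or `bin_values[r] ≠ ∅`. -/
inductive StartRule where
  | quorum
  | delivered

/-- Whether the timeout value grows by one in each round (at New1 only), or in each
mini-round (at New1 and at New4). -/
inductive GrowthRule where
  | perRound
  | perMiniRound

/-- Local variables of a process. -/
structure LocalState (n : ℕ) where
  pc : PC
  round : ℕ
  est : Bool
  timeout : ℕ
  timer : Timer
  /-- the set `aux` that the process has broadcast in the current round -/
  aux : Finset Bool
  /-- `bin r` is `bin_values[r]`, listed in the order in which the values entered it -/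
  bin : ℕ → List Bool
  /-- the pairs `(r, v)` such that `B_VAL(v)` of `EST[r]` was already broadcast -/
  bcast : Set (ℕ × Bool)
  /-- the messages received so far, with their senders -/
  rcv : Set (Fin n × Msg)
  decided : Option Bool

def LocalState.initial (n : ℕ) : LocalState n where
  pc := .idle
  round := 0
  est := false
  timeout := 0
  timer := .off
  aux := ∅
  bin := fun _ => []
  bcast := ∅
  rcv := ∅
  decided := none

/-- The bit `r mod 2`. -/
def roundBit (r : ℕ) : Bool := decide (r % 2 = 1)

/-- `j` is the weak coordinator of round `r` (with processes numbered from `0` and rounds from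
`1`). -/
def IsCoord {n : ℕ} (j : Fin n) (r : ℕ) : Prop := (j : ℕ) = (r - 1) % n

namespace LocalState

variable {n : ℕ}

/-- The number of different processes from which a message with property `P` was received. -/
noncomputable def numSenders (s : LocalState n) (P : Msg → Prop) : ℕ :=
  Set.ncard {j : Fin n | ∃ m, P m ∧ (j, m) ∈ s.rcv}

/-- The mini-round the process is in. -/
def miniRound (s : LocalState n) : ℕ :=
  match s.pc with
  | .idle | .new1 | .new2 | .m05 => 2 * s.round
  | .new4 | .m07 => 2 * s.round + 1

/-- Catch-up: messages of one and the same later mini-round were received from `t + 1` different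
processes. -/
def CatchUp (t : ℕ) (s : LocalState n) : Prop :=
  ∃ ρ, s.miniRound < ρ ∧ t + 1 ≤ s.numSenders (fun m => m.miniRound = ρ)

/-- The process need not wait for its timer (any more). -/
def TimerDone (t : ℕ) (s : LocalState n) : Prop := s.timer = .expired ∨ s.CatchUp t

/-- The condition awaited at line New1. -/
def StartCond (t : ℕ) (rule : StartRule) (s : LocalState n) : Prop :=
  match rule with
  | .quorum => n - t ≤ s.numSenders (fun m => ∃ v, m = .est s.round v)
  | .delivered => s.bin s.round ≠ []

/-- The coordinator's value `w` was received in the current round and lies in `bin_values`. -/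
def CoordValue (s : LocalState n) (w : Bool) : Prop :=
  (∃ j : Fin n, IsCoord j s.round ∧ (j, Msg.coord s.round w) ∈ s.rcv) ∧ w ∈ s.bin s.round

/-- Line New3: the possible new values of `aux`. -/
def NewAux (s : LocalState n) (A : Finset Bool) : Prop :=
  (∃ w, s.CoordValue w ∧ A = {w}) ∨ ((∀ w, ¬ s.CoordValue w) ∧ A = (s.bin s.round).toFinset)

/-- The predicate on `values` at line M-07: `V` is a non-empty subset of `bin_values[r]` and is the
union of the contents of `AUX[r]` messages received from `n - t` different processes. -/
def ValuesOK (t : ℕ) (s : LocalState n) (V : Finset Bool) : Prop :=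
  V.Nonempty ∧ V ⊆ (s.bin s.round).toFinset ∧
    ∃ (Q : Finset (Fin n)) (b : Fin n → Finset Bool), Q.card = n - t ∧
      (∀ j ∈ Q, (j, Msg.aux s.round (b j)) ∈ s.rcv) ∧ V = Q.biUnion b

/-- Lines M-07 and New5: the possible results `values`; if several sets qualify and one of them is
`aux`, then `aux` is taken. -/
def Values (t : ℕ) (s : LocalState n) (V : Finset Bool) : Prop :=
  s.ValuesOK t V ∧ (s.ValuesOK t s.aux → V = s.aux)

/-- Lines 03 and 04: go to the next round with estimate `e` and BV-broadcast it. -/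
def nextRound (s : LocalState n) (e : Bool) : LocalState n :=
  { s with
    pc := .new1
    round := s.round + 1
    est := e
    timer := .off
    bcast := insert (s.round + 1, e) s.bcast }

end LocalState

/-- The actions of the algorithm (one per line at which it can wait, and the two handlers of the
BV-broadcast). -/
inductive Action where
  | start
  | echo (r : ℕ) (v : Bool)
  | bvDeliver (r : ℕ) (v : Bool)
  | new1
  | new2
  | m05
  | new4
  | m07

/-- `LocalStep t sr gr x i now a s s' out`: process `i`, whose input is `x`, can execute action `a`
in state `s` at the instant `now`; it goes to `s'` and broadcasts the messages in `out`. -/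
inductive LocalStep {n : ℕ} (t : ℕ) (sr : StartRule) (gr : GrowthRule) (x : Bool) (i : Fin n)
    (now : ℝ) : Action → LocalState n → LocalState n → Set Msg → Prop where
  /-- lines 01 to 04 -/
  | start (s : LocalState n) (hpc : s.pc = .idle) :
      LocalStep t sr gr x i now .start s (s.nextRound x) {Msg.est (s.round + 1) x}
  /-- `B_VAL(v)` received from `t + 1` processes and not yet broadcast -/
  | echo (s : LocalState n) (r : ℕ) (v : Bool) (hpc : s.pc ≠ .idle)
      (hq : t + 1 ≤ s.numSenders (fun m => m = .est r v)) (hb : (r, v) ∉ s.bcast) :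
      LocalStep t sr gr x i now (.echo r v) s { s with bcast := insert (r, v) s.bcast }
        {Msg.est r v}
  /-- `B_VAL(v)` received from `2t + 1` processes -/
  | bvDeliver (s : LocalState n) (r : ℕ) (v : Bool) (hpc : s.pc ≠ .idle)
      (hq : 2 * t + 1 ≤ s.numSenders (fun m => m = .est r v)) (hb : v ∉ s.bin r) :
      LocalStep t sr gr x i now (.bvDeliver r v) s
        { s with bin := Function.update s.bin r (s.bin r ++ [v]) } ∅
  | new1 (s : LocalState n) (hpc : s.pc = .new1) (hq : s.StartCond t sr) :
      LocalStep t sr gr x i now .new1 s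
        { s with
          pc := .new2
          timeout := s.timeout + 1
          timer := .running now (s.timeout + 1) } ∅
  /-- line New2 at a process that does not coordinate the round -/
  | new2Other (s : LocalState n) (hpc : s.pc = .new2) (hc : ¬ IsCoord i s.round) :
      LocalStep t sr gr x i now .new2 s { s with pc := .m05 } ∅
  /-- line New2 at the coordinator; `w` is the first value that entered `bin_values` -/
  | new2Coord (s : LocalState n) (w : Bool) (hpc : s.pc = .new2) (hc : IsCoord i s.round)
      (hw : (s.bin s.round).head? = some w) :
      LocalStep t sr gr x i now .new2 s { s with pc := .m05 } {Msg.coord s.round w}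
  /-- lines M-05, New3, M-06 -/
  | m05 (s : LocalState n) (A : Finset Bool) (hpc : s.pc = .m05) (hb : s.bin s.round ≠ [])
      (ht : s.TimerDone t) (hA : s.NewAux A) :
      LocalStep t sr gr x i now .m05 s { s with pc := .new4, timer := .off, aux := A }
        {Msg.aux s.round A}
  | new4 (s : LocalState n) (T : ℕ) (hpc : s.pc = .new4)
      (hq : n - t ≤ s.numSenders (fun m => ∃ S, m = .aux s.round S))
      (hT : T = match gr with | .perRound => s.timeout | .perMiniRound => s.timeout + 1) :
      LocalStep t sr gr x i now .new4 s
        { s with pc := .m07, timeout := T, timer := .running now T } ∅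
  /-- lines M-07, New5, 08 to 10, and 03, 04 of the next round, when `values` is a singleton -/
  | m07Single (s : LocalState n) (v : Bool) (hpc : s.pc = .m07) (ht : s.TimerDone t)
      (hV : s.Values t {v}) :
      LocalStep t sr gr x i now .m07 s
        { s.nextRound v with
          decided := if v = roundBit s.round then s.decided.or (some v) else s.decided }
        {Msg.est (s.round + 1) v}
  /-- lines M-07, New5, 08, 09, 11, and 03, 04 of the next round, when `values = {0, 1}` -/
  | m07Both (s : LocalState n) (hpc : s.pc = .m07) (ht : s.TimerDone t)
      (hV : s.Values t {false, true}) :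
      LocalStep t sr gr x i now .m07 s (s.nextRound (roundBit s.round))
        {Msg.est (s.round + 1) (roundBit s.round)}

/-- Action `a` of process `i` is executable in the local state `s`. -/
def Enabled {n : ℕ} (t : ℕ) (sr : StartRule) (gr : GrowthRule) (x : Bool) (i : Fin n)
    (a : Action) (s : LocalState n) : Prop :=
  ∃ (now : ℝ) (s' : LocalState n) (out : Set Msg), LocalStep t sr gr x i now a s s' out

/-- Global configuration: the local states (only those of non-faulty processes are meaningful) and
the triples (sender, receiver, message) sent so far. -/
structure Config (n : ℕ) where
  loc : Fin n → LocalState n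
  sent : Set (Fin n × Fin n × Msg)

def Config.initial (n : ℕ) : Config n where
  loc := fun _ => LocalState.initial n
  sent := ∅

/-- Events of the system at the instant `now`. -/
inductive Step {n : ℕ} (t : ℕ) (sr : StartRule) (gr : GrowthRule) (faulty : Finset (Fin n))
    (x : Fin n → Bool) (now : ℝ) : Config n → Config n → Prop where
  /-- nothing happens -/
  | stutter (c : Config n) : Step t sr gr faulty x now c c
  /-- a message that was sent is received -/
  | receive (c : Config n) (i j : Fin n) (m : Msg) (hm : (i, j, m) ∈ c.sent) :
      Step t sr gr faulty x now c
        { c with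
          loc := Function.update c.loc j { c.loc j with rcv := insert (i, m) (c.loc j).rcv } }
  /-- a non-faulty process executes an action -/
  | act (c : Config n) (i : Fin n) (a : Action) (s' : LocalState n) (out : Set Msg)
      (hi : i ∉ faulty) (h : LocalStep t sr gr (x i) i now a (c.loc i) s' out) :
      Step t sr gr faulty x now c
        { loc := Function.update c.loc i s'
          sent := c.sent ∪ {p | p.1 = i ∧ p.2.2 ∈ out} }
  /-- the running timer of a non-faulty process expires -/
  | expire (c : Config n) (i : Fin n) (since : ℝ) (T : ℕ) (hi : i ∉ faulty)
      (h : (c.loc i).timer = .running since T) :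
      Step t sr gr faulty x now c
        { c with loc := Function.update c.loc i { c.loc i with timer := .expired } }
  /-- a Byzantine process sends an arbitrary message, under its own identity -/
  | byzantine (c : Config n) (i j : Fin n) (m : Msg) (hi : i ∈ faulty) :
      Step t sr gr faulty x now c { c with sent := insert (i, j, m) c.sent }

/-- Executions of the algorithm in the asynchronous Byzantine message-passing model, where
`faulty` is the set of Byzantine processes and process `i` proposes `x i`.  The `k`-th
configuration holds from the instant `time k` to the instant `time (k + 1)`, at which the next
event takes place. -/
structure Execution (n t : ℕ) (sr : StartRule) (gr : GrowthRule) (faulty : Finset (Fin n))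
    (x : Fin n → Bool) where
  cfg : ℕ → Config n
  time : ℕ → ℝ
  cfg_zero : cfg 0 = Config.initial n
  step : ∀ k, Step t sr gr faulty x (time (k + 1)) (cfg k) (cfg (k + 1))
  time_mono : Monotone time
  time_unbounded : Filter.Tendsto time Filter.atTop Filter.atTop
  /-- messages between non-faulty processes are received after a finite time -/
  reliable : ∀ i ∉ faulty, ∀ j ∉ faulty, ∀ m k, (i, j, m) ∈ (cfg k).sent →
    ∃ k', (i, m) ∈ ((cfg k').loc j).rcv
  /-- a non-faulty process does not leave an action executable forever without executing it (in
  particular, it eventually invokes `bin_propose`) -/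
  progress : ∀ i ∉ faulty, ∀ a k, Enabled t sr gr (x i) i a ((cfg k).loc i) →
    ∃ k' ≥ k, ¬ Enabled t sr gr (x i) i a ((cfg k').loc i)
  /-- a timer does not run forever -/
  timers : ∀ i ∉ faulty, ∀ k since T, ((cfg k).loc i).timer = .running since T →
    ∃ k' ≥ k, ((cfg k').loc i).timer ≠ .running since T

namespace Execution

variable {n t : ℕ} {sr : StartRule} {gr : GrowthRule} {faulty : Finset (Fin n)}
  {x : Fin n → Bool}

/-- The eventual synchrony assumption: from some instant `τ` on, there are bounds, all of them
unknown to the processes, on message transfer delays (`δ`), on processing times (`θ`) and on the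
rates of the local clocks (between `1 / c` and `c`). -/
def EventuallySynchronous (e : Execution n t sr gr faulty x) : Prop :=
  ∃ τ δ θ c : ℝ, 0 ≤ δ ∧ 0 ≤ θ ∧ 1 ≤ c ∧
    -- a message sent between non-faulty processes after `τ` is received within `δ`
    (∀ i ∉ faulty, ∀ j ∉ faulty, ∀ m k, (i, j, m) ∉ (e.cfg k).sent →
      (i, j, m) ∈ (e.cfg (k + 1)).sent → τ ≤ e.time (k + 1) →
      ∃ k', e.time k' ≤ e.time (k + 1) + δ ∧ (i, m) ∈ ((e.cfg k').loc j).rcv) ∧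
    -- after `τ`, a process that has started needs at most `θ` to execute an executable action
    (∀ i ∉ faulty, ∀ a, a ≠ Action.start → ∀ k, τ ≤ e.time k →
      Enabled t sr gr (x i) i a ((e.cfg k).loc i) →
      ∃ k' ≥ k, e.time k' ≤ e.time k + θ ∧ ¬ Enabled t sr gr (x i) i a ((e.cfg k').loc i)) ∧
    -- a timer set to `T` after `τ` expires no earlier than `T / c` time units later ...
    (∀ i ∉ faulty, ∀ k since T, τ ≤ since → ((e.cfg k).loc i).timer = .running since T →
      ((e.cfg (k + 1)).loc i).timer = .expired → since + T / c ≤ e.time (k + 1)) ∧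
    -- ... and does not run for more than `c * T` time units
    (∀ i ∉ faulty, ∀ k since T, τ ≤ since → ((e.cfg k).loc i).timer = .running since T →
      e.time (k + 1) ≤ since + c * T)

/-- Process `i` has decided `v` in the `k`-th configuration. -/
def Decided (e : Execution n t sr gr faulty x) (k : ℕ) (i : Fin n) (v : Bool) : Prop :=
  ((e.cfg k).loc i).decided = some v

/-- BBC-Validity: a value decided by a non-faulty process was proposed by a non-faulty process. -/
def Validity (e : Execution n t sr gr faulty x) : Prop :=
  ∀ i ∉ faulty, ∀ k v, e.Decided k i v → ∃ j ∉ faulty, x j = v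

/-- BBC-Agreement: no two non-faulty processes decide different values (and no process changes its
decision). -/
def Agreement (e : Execution n t sr gr faulty x) : Prop :=
  ∀ i ∉ faulty, ∀ j ∉ faulty, ∀ k l v w, e.Decided k i v → e.Decided l j w → v = w

/-- BBC-Termination: every non-faulty process decides. -/
def Termination (e : Execution n t sr gr faulty x) : Prop :=
  ∀ i ∉ faulty, ∃ k v, e.Decided k i v

end Execution

end BBC

/-!
# Binary Byzantine consensus with weak coordinators and catch-up

**Safety.** A value enters `bin_values` of a correct process only if `2t + 1` processes have
broadcast it, hence (`bin_justified`) only if it is the estimate of some correct process in that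
round.  Therefore estimates never leave the set of proposed values (`est_proposed`), and once all
correct processes enter a round with the same estimate, they keep it for ever (`Unanimous.of_le`).
Two quorums of `AUX` messages of a round share a correct sender, which sends only one set
(`values_inter`); so if `v` is decided in round `r`, every other process has `v` in its `values`, and
as `v` is the bit of the round, it enters the next round with estimate `v`
(`unanimous_of_values`).  Agreement follows.

**Progress.** The analysis of a round (`Paced.round_progress`) is carried out for an abstract clock.
For a clock that stands still it says that correct processes go through all rounds
(`exists_all_pos`); for the real clock it says that a round in which nobody has to wait for timers
takes a bounded time after the stabilization.

**Termination.** A process catches up only with messages of later mini-rounds, and such messages are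
sent by correct processes only when one of them has reached this mini-round.  So the *first* correct
process to leave a mini-round has waited for its timer to expire, and between the first setting of a
timer and the first departure in a mini-round of round `r` there are at least `r / c` time units
(`first_timer`, `second_timer`).  Conversely, when the first correct process sets its
timer in a new round, `t + 1` correct processes have sent `B_VAL` messages of this round, so that all
slower processes stop waiting for timers and need a bounded time for each round they are behind
(`round_catchUp`).  As the timeouts grow, the delay between the first and the last correct process
becomes bounded (`lag`).  In a late enough round with a correct coordinator, all correct processes
thus receive the value `w` of the coordinator before any of them stops waiting, so they all send
`AUX({w})`, and thanks to the second timer they all receive these messages from each other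
before they compute `values`, which is then `aux = {w}` (`unanimous_of_coord`).  From then on the
correct processes are unanimous, and they decide in the next round whose bit is `w`
(`termination_of_unanimous`).
-/

namespace BBC

/-! ### Single steps of one process -/

namespace LocalState

variable {n : ℕ}

/-- A linear measure of the progress of a process: five positions for each round, one for each line
at which a process can wait, and `0` before the start.  Each executed line moves a process to the
next position, except that `start` leads from `0` to position `5` (line New1 of round `1`). -/
def pos (s : LocalState n) : ℕ :=
  match s.pc with
  | .idle => 0
  | .new1 => 5 * s.round
  | .new2 => 5 * s.round + 1
  | .m05 => 5 * s.round + 2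
  | .new4 => 5 * s.round + 3
  | .m07 => 5 * s.round + 4

theorem pc_ne_idle_of_pos {s : LocalState n} (h : 1 ≤ s.pos) : s.pc ≠ .idle := by
  intro hpc; simp [pos, hpc] at h

theorem pos_new1 {s : LocalState n} {r : ℕ} (hr : 1 ≤ r) (h : s.pos = 5 * r) :
    s.pc = .new1 ∧ s.round = r := by
  cases hpc : s.pc <;> simp [pos, hpc] at h ⊢ <;> omega

theorem pos_new2 {s : LocalState n} {r : ℕ} (h : s.pos = 5 * r + 1) :
    s.pc = .new2 ∧ s.round = r := by
  cases hpc : s.pc <;> simp [pos, hpc] at h ⊢ <;> omega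

theorem pos_m05 {s : LocalState n} {r : ℕ} (h : s.pos = 5 * r + 2) :
    s.pc = .m05 ∧ s.round = r := by
  cases hpc : s.pc <;> simp [pos, hpc] at h ⊢ <;> omega

theorem pos_new4 {s : LocalState n} {r : ℕ} (h : s.pos = 5 * r + 3) :
    s.pc = .new4 ∧ s.round = r := by
  cases hpc : s.pc <;> simp [pos, hpc] at h ⊢ <;> omega

theorem pos_m07 {s : LocalState n} {r : ℕ} (h : s.pos = 5 * r + 4) :
    s.pc = .m07 ∧ s.round = r := by
  cases hpc : s.pc <;> simp [pos, hpc] at h ⊢ <;> omega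

theorem round_le_of_pos {s : LocalState n} {r : ℕ} (h : 5 * r ≤ s.pos) : r ≤ s.round := by
  cases hpc : s.pc <;> simp [pos, hpc] at h <;> omega

theorem le_pos_of_round {s : LocalState n} (hs : s.pc = .idle → s.round = 0) {r : ℕ}
    (h : r ≤ s.round) : 5 * r ≤ s.pos := by
  cases hpc : s.pc <;> simp [pos, hpc] at hs ⊢ <;> omega

theorem miniRound_le {s : LocalState n} (hs : s.pc = .idle → s.round = 0) {r : ℕ} (hr : 1 ≤ r)
    (h : s.pos < 5 * r) : s.miniRound < 2 * r := by
  cases hpc : s.pc <;> simp [pos, miniRound, hpc] at hs h ⊢ <;> omega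

theorem pos_of_miniRound_odd {s : LocalState n}
    (hs : s.pc = .idle → s.round = 0) {r : ℕ} (h : 2 * r + 1 ≤ s.miniRound) :
    5 * r + 3 ≤ s.pos := by
  cases hpc : s.pc <;> simp [pos, miniRound, hpc] at hs h ⊢ <;> omega

theorem pos_of_miniRound_even {s : LocalState n}
    (hs : s.pc = .idle → s.round = 0) {r : ℕ} (h : 2 * r + 2 ≤ s.miniRound) :
    5 * (r + 1) ≤ s.pos := by
  cases hpc : s.pc <;> simp [pos, miniRound, hpc] at hs h ⊢ <;> omega

theorem miniRound_of_pos_even {s : LocalState n} {r : ℕ}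
    (h : 5 * r ≤ s.pos) : 2 * r ≤ s.miniRound := by
  cases hpc : s.pc <;> simp [pos, miniRound, hpc] at h ⊢ <;> omega

theorem miniRound_of_pos_odd {s : LocalState n} {r : ℕ}
    (h : 5 * r + 3 ≤ s.pos) : 2 * r + 1 ≤ s.miniRound := by
  cases hpc : s.pc <;> simp [pos, miniRound, hpc] at h ⊢ <;> omega

theorem miniRound_m05 {s : LocalState n} (h : s.pc = .m05) : s.miniRound = 2 * s.round := by
  simp [miniRound, h]

theorem miniRound_m07 {s : LocalState n} (h : s.pc = .m07) : s.miniRound = 2 * s.round + 1 := by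
  simp [miniRound, h]

/-- The process is at a line of a phase in which its timer has been set. -/
def Timed (s : LocalState n) : Prop := s.pc = .new2 ∨ s.pc = .m05 ∨ s.pc = .m07

/-- The position at which a process arrives when it sets the timer of its current mini-round. -/
def phaseStart (s : LocalState n) : ℕ :=
  match s.pc with
  | .m07 => 5 * s.round + 4
  | _ => 5 * s.round + 1

/-- How a local state evolves: the position, the round and the sets only grow, the estimate is kept
within a round, at one position the timer can only expire, and a decision is final. -/
structure Grows (s s' : LocalState n) : Prop where
  pos_le : s.pos ≤ s'.pos
  round_le : s.round ≤ s'.round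
  rcv : s.rcv ⊆ s'.rcv
  bin : ∀ r v, v ∈ s.bin r → v ∈ s'.bin r
  bcast : s.bcast ⊆ s'.bcast
  est : s.pc ≠ .idle → s.round = s'.round → s'.est = s.est
  timer : s.pos = s'.pos → s'.timer = s.timer ∨ s'.timer = .expired
  decided : s.decided ≠ none → s'.decided = s.decided

theorem Grows.refl (s : LocalState n) : s.Grows s :=
  ⟨le_rfl, le_rfl, subset_rfl, fun _ _ h => h, subset_rfl, fun _ _ => rfl, fun _ => .inl rfl,
    fun _ => rfl⟩

theorem Grows.trans {s s' s'' : LocalState n} (hs : s.pc ≠ .idle → s'.pc ≠ .idle)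
    (h : s.Grows s') (h' : s'.Grows s'') : s.Grows s'' where
  pos_le := h.pos_le.trans h'.pos_le
  round_le := h.round_le.trans h'.round_le
  rcv := h.rcv.trans h'.rcv
  bin r v hv := h'.bin r v (h.bin r v hv)
  bcast := h.bcast.trans h'.bcast
  est hpc hr := by
    have := h.round_le; have := h'.round_le
    rw [h'.est (hs hpc) (by omega), h.est hpc (by omega)]
  timer hp := by
    have := h.pos_le; have := h'.pos_le
    rcases h.timer (by omega) with h1 | h1 <;> rcases h'.timer (by omega) with h2 | h2 <;>
      simp [h1, h2]
  decided hd := by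
    have := h.decided hd
    rw [h'.decided (by rwa [this]), this]

/-! ### Counting the senders of messages -/

theorem numSenders_mono {s s' : LocalState n} (h : s.rcv ⊆ s'.rcv) (P : Msg → Prop) :
    s.numSenders P ≤ s'.numSenders P :=
  Set.ncard_le_ncard (fun _ ⟨m, hm, hj⟩ => ⟨m, hm, h hj⟩) (Set.toFinite _)

theorem card_le_numSenders {s : LocalState n} {P : Msg → Prop} (A : Finset (Fin n))
    (hA : ∀ j ∈ A, ∃ m, P m ∧ (j, m) ∈ s.rcv) : A.card ≤ s.numSenders P := by
  rw [← Set.ncard_coe_finset]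
  exact Set.ncard_le_ncard (fun j hj => hA j hj) (Set.toFinite _)

theorem exists_correct_senders {s : LocalState n} {P : Msg → Prop} {t a : ℕ}
    {faulty : Finset (Fin n)} (hf : faulty.card ≤ t) (h : a + t ≤ s.numSenders P) :
    ∃ A : Finset (Fin n), a ≤ A.card ∧ ∀ j ∈ A, j ∉ faulty ∧ ∃ m, P m ∧ (j, m) ∈ s.rcv := by
  classical
  refine ⟨(Finset.univ.filter fun j => ∃ m, P m ∧ (j, m) ∈ s.rcv) \ faulty, ?_, ?_⟩
  · have h1 := Finset.le_card_sdiff faulty (Finset.univ.filter fun j => ∃ m, P m ∧ (j, m) ∈ s.rcv)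
    have h2 : s.numSenders P = (Finset.univ.filter fun j => ∃ m, P m ∧ (j, m) ∈ s.rcv).card := by
      rw [numSenders, ← Set.ncard_coe_finset]; simp
    omega
  · intro j hj
    simp only [Finset.mem_sdiff, Finset.mem_filter, Finset.mem_univ, true_and] at hj
    exact ⟨hj.2, hj.1⟩

theorem exists_correct_sender {s : LocalState n} {P : Msg → Prop} {t : ℕ}
    {faulty : Finset (Fin n)} (hf : faulty.card ≤ t) (h : t + 1 ≤ s.numSenders P) :
    ∃ j, j ∉ faulty ∧ ∃ m, P m ∧ (j, m) ∈ s.rcv := by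
  obtain ⟨A, hA, hA'⟩ := exists_correct_senders (a := 1) hf (by omega : 1 + t ≤ s.numSenders P)
  obtain ⟨j, hj⟩ := Finset.card_pos.1 hA
  exact ⟨j, hA' j hj⟩

/-! ### The choices of `aux` and `values` -/

theorem exists_values {s : LocalState n} {t : ℕ} {V : Finset Bool} (hV : s.ValuesOK t V) :
    ∃ V, s.Values t V := by
  by_cases h : s.ValuesOK t s.aux
  · exact ⟨_, h, fun _ => rfl⟩
  · exact ⟨V, hV, fun h' => absurd h' h⟩

theorem exists_newAux (s : LocalState n) : ∃ A, s.NewAux A := by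
  by_cases h : ∃ w, s.CoordValue w
  · obtain ⟨w, hw⟩ := h
    exact ⟨_, .inl ⟨w, hw, rfl⟩⟩
  · push Not at h
    exact ⟨_, .inr ⟨h, rfl⟩⟩

theorem NewAux.subset {s : LocalState n} {A : Finset Bool} (h : s.NewAux A) :
    A ⊆ (s.bin s.round).toFinset := by
  rcases h with ⟨w, hw, rfl⟩ | ⟨_, rfl⟩
  · simpa using hw.2
  · exact subset_rfl

theorem NewAux.nonempty {s : LocalState n} {A : Finset Bool} (h : s.NewAux A)
    (hb : s.bin s.round ≠ []) : A.Nonempty := by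
  rcases h with ⟨w, hw, rfl⟩ | ⟨_, rfl⟩
  · simp
  · simpa using hb

/-- A non-empty set of bits is a singleton or the whole of `Bool`. -/
theorem eq_singleton_or_univ {V : Finset Bool} (h : V.Nonempty) :
    (∃ v, V = {v}) ∨ V = {false, true} := by
  revert h; revert V; decide

end LocalState

variable {n t : ℕ} {sr : StartRule} {gr : GrowthRule} {x : Bool} {i : Fin n} {now : ℝ}
  {a : Action} {s s' : LocalState n} {out : Set Msg}

namespace LocalStep

theorem rcv_eq (h : LocalStep t sr gr x i now a s s' out) : s'.rcv = s.rcv := by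
  cases h <;> rfl

theorem pc_ne_idle (h : LocalStep t sr gr x i now a s s' out) : s'.pc ≠ .idle := by
  cases h <;> simp_all [LocalState.nextRound]

theorem grows (h : LocalStep t sr gr x i now a s s' out) (hs : s.pc = .idle → s.round = 0) :
    s.Grows s' := by
  cases h
  case m07Single v hpc ht hV =>
    refine ⟨?_, ?_, ?_, ?_, ?_, ?_, ?_, ?_⟩ <;>
      simp_all [LocalState.nextRound, LocalState.pos] <;> try omega
    intro hd
    obtain ⟨b, hb⟩ := Option.ne_none_iff_exists'.1 hd
    simp [hb]
  all_goals
    refine ⟨?_, ?_, ?_, ?_, ?_, ?_, ?_, ?_⟩ <;>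
      simp_all [LocalState.nextRound, LocalState.pos, Function.update_apply] <;>
      first | omega | grind

theorem bin_cases (h : LocalStep t sr gr x i now a s s' out) {r : ℕ} {v : Bool}
    (hv : v ∈ s'.bin r) : v ∈ s.bin r ∨ 2 * t + 1 ≤ s.numSenders (fun m => m = .est r v) := by
  cases h
  case bvDeliver r' v' hpc hq hb =>
    by_cases hr : r = r'
    · subst hr
      simp only [Function.update_self, List.mem_append, List.mem_singleton] at hv
      rcases hv with hv | rfl
      · exact .inl hv
      · exact .inr hq
    · simp only [Function.update_of_ne hr] at hv
      exact .inl hv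
  all_goals exact .inl hv

theorem bcast_iff (h : LocalStep t sr gr x i now a s s' out) (r : ℕ) (v : Bool) :
    (r, v) ∈ s'.bcast ↔ (r, v) ∈ s.bcast ∨ Msg.est r v ∈ out := by
  cases h <;> simp [LocalState.nextRound] <;> tauto

theorem est_out (h : LocalStep t sr gr x i now a s s' out) {r : ℕ} {v : Bool}
    (hm : Msg.est r v ∈ out) :
    (1 ≤ r ∧ s'.round = r ∧ s'.est = v) ∨ t + 1 ≤ s.numSenders (fun m => m = .est r v) := by
  cases h <;> simp_all [LocalState.nextRound]

theorem coord_out (h : LocalStep t sr gr x i now a s s' out) {r : ℕ} {w : Bool}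
    (hm : Msg.coord r w ∈ out) :
    s.pos = 5 * r + 1 ∧ s'.pos = 5 * r + 2 ∧ (s.bin r).head? = some w := by
  cases h <;> simp_all [LocalState.pos]

theorem aux_out (h : LocalStep t sr gr x i now a s s' out) {r : ℕ} {A : Finset Bool}
    (hm : Msg.aux r A ∈ out) :
    s.pos = 5 * r + 2 ∧ s'.pos = 5 * r + 3 ∧ s.bin r ≠ [] ∧ s.NewAux A ∧ s'.aux = A := by
  cases h <;> simp_all [LocalState.pos]

/-- A process that passes line New1 of round `r` executes just this line.  This and the following
lemmas describe the action by which a process passes the various lines of a round. -/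
theorem cross_new1 (h : LocalStep t sr gr x i now a s s' out) (hs : s.pc = .idle → s.round = 0)
    {r : ℕ} (hr : 1 ≤ r) (h1 : s.pos < 5 * r + 1) (h2 : 5 * r + 1 ≤ s'.pos) :
    s.pos = 5 * r ∧ s'.pos = 5 * r + 1 ∧ s.StartCond t sr := by
  cases h <;> simp_all [LocalState.nextRound, LocalState.pos] <;> omega

theorem cross_new2 (h : LocalStep t sr gr x i now a s s' out) (hs : s.pc = .idle → s.round = 0)
    {r : ℕ} (hr : 1 ≤ r) (h1 : s.pos < 5 * r + 2) (h2 : 5 * r + 2 ≤ s'.pos) :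
    s.pos = 5 * r + 1 ∧ (IsCoord i r → ∃ w, w ∈ s.bin r ∧ Msg.coord r w ∈ out) := by
  cases h <;> simp_all [LocalState.nextRound, LocalState.pos] <;> try omega
  case new2Other => obtain rfl : s.round = r := by omega
                    tauto
  case new2Coord w hpc hc hw =>
    obtain rfl : s.round = r := by omega
    exact ⟨rfl, fun _ => ⟨List.mem_of_mem_head? (Option.mem_def.2 hw), rfl⟩⟩

theorem cross_m05 (h : LocalStep t sr gr x i now a s s' out) (hs : s.pc = .idle → s.round = 0)
    {r : ℕ} (hr : 1 ≤ r) (h1 : s.pos < 5 * r + 3) (h2 : 5 * r + 3 ≤ s'.pos) :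
    s.pos = 5 * r + 2 ∧ s.TimerDone t ∧ s.bin r ≠ [] ∧ ∃ A, s.NewAux A ∧ Msg.aux r A ∈ out := by
  cases h <;> simp_all [LocalState.nextRound, LocalState.pos] <;> try omega
  obtain rfl : s.round = r := by omega
  simp_all

theorem cross_new4 (h : LocalStep t sr gr x i now a s s' out) (hs : s.pc = .idle → s.round = 0)
    {r : ℕ} (hr : 1 ≤ r) (h1 : s.pos < 5 * r + 4) (h2 : 5 * r + 4 ≤ s'.pos) :
    s.pos = 5 * r + 3 ∧ n - t ≤ s.numSenders (fun m => ∃ S, m = .aux r S) := by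
  cases h <;> simp_all [LocalState.nextRound, LocalState.pos] <;> try omega
  obtain rfl : s.round = r := by omega
  simp_all

/-- What happens when a process leaves round `r`: the timer is done, and the next estimate and a
possible decision come from `values`. -/
theorem cross_m07 (h : LocalStep t sr gr x i now a s s' out) (hs : s.pc = .idle → s.round = 0)
    {r : ℕ} (hr : 1 ≤ r) (h1 : s.pos < 5 * (r + 1)) (h2 : 5 * (r + 1) ≤ s'.pos) :
    s.pos = 5 * r + 4 ∧ s'.pos = 5 * (r + 1) ∧ s.TimerDone t ∧ ∃ V, s.Values t V ∧
      ((∃ v, V = {v} ∧ s'.est = v ∧ (v = roundBit r → s'.decided ≠ none)) ∨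
        (V = {false, true} ∧ s'.est = roundBit r)) := by
  cases h <;> simp only [LocalState.nextRound, LocalState.pos] at * <;> simp_all <;> try omega
  · obtain rfl : s.round = r := by omega
    refine ⟨rfl, _, ‹_›, .inl ⟨rfl, ?_⟩⟩
    rintro rfl
    cases s.decided <;> simp
  · obtain rfl : s.round = r := by omega
    exact ⟨rfl, _, ‹_›, .inr ⟨rfl, rfl⟩⟩

theorem decided_cases (h : LocalStep t sr gr x i now a s s' out) {v : Bool}
    (hv : s'.decided = some v) : s.decided = some v ∨
      (s.pc = .m07 ∧ v = roundBit s.round ∧ s.Values t {v}) := by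
  cases h
  case m07Single w hpc ht hV =>
    simp only at hv
    split_ifs at hv with hw
    · cases hd : s.decided with
      | some u => left; simpa [hd] using hv
      | none =>
        right
        simp only [hd, Option.none_or, Option.some.injEq] at hv
        exact ⟨hpc, hv ▸ hw, hv ▸ hV⟩
    · exact .inl hv
  all_goals exact .inl hv

/-- Entering a round: either the process has just started, or it leaves the previous round. -/
theorem round_cases (h : LocalStep t sr gr x i now a s s' out) (hs : s.pc = .idle → s.round = 0) :
    s'.round = s.round ∨ (s.pc = .idle ∧ s'.round = 1 ∧ s'.est = x) ∨
      (s.pc = .m07 ∧ s'.round = s.round + 1) := by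
  cases h <;> simp_all [LocalState.nextRound]

theorem one_le_round (h : LocalStep t sr gr x i now a s s' out) (hs : s.pc ≠ .idle → 1 ≤ s.round) :
    1 ≤ s'.round := by
  cases h <;> simp_all [LocalState.nextRound]

theorem cross_new (h : LocalStep t sr gr x i now a s s' out) (hs : s.pc = .idle → s.round = 0)
    {r : ℕ} (hr : 1 ≤ r) (h1 : s.pos < 5 * r) (h2 : 5 * r ≤ s'.pos) :
    s'.round = r ∧ (r, s'.est) ∈ s'.bcast := by
  cases h <;> simp_all [LocalState.nextRound, LocalState.pos] <;> try omega

theorem aux_cases (h : LocalStep t sr gr x i now a s s' out) (hpc : s'.pc = .new4 ∨ s'.pc = .m07) :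
    ((s.pc = .new4 ∨ s.pc = .m07) ∧ s'.aux = s.aux ∧ s'.round = s.round) ∨
      Msg.aux s'.round s'.aux ∈ out := by
  cases h <;> simp_all [LocalState.nextRound]

/-- The timeout value is at least the number of the round, from New1 of this round on. -/
theorem timeout_ge (h : LocalStep t sr gr x i now a s s' out)
    (hT : s.round ≤ s.timeout + 1 ∧ (s.pc ≠ .new1 → s.round ≤ s.timeout)) :
    s'.round ≤ s'.timeout + 1 ∧ (s'.pc ≠ .new1 → s'.round ≤ s'.timeout) := by
  cases h
  case new4 hT' => cases gr <;> (simp_all <;> omega)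
  all_goals simp_all [LocalState.nextRound] <;> try omega

/-- An action either leaves the timer and its phase alone, or stops the timer and ends the phase, or
begins a phase by setting the timer to at least the number of the round. -/
theorem timer_cases (h : LocalStep t sr gr x i now a s s' out)
    (hT : s.round ≤ s.timeout + 1 ∧ (s.pc ≠ .new1 → s.round ≤ s.timeout)) :
    (s'.timer = s.timer ∧ s'.phaseStart = s.phaseStart ∧ s'.round = s.round ∧
        (s'.Timed → s.Timed)) ∨
      (s'.timer = .off ∧ ¬ s'.Timed) ∨
      (∃ T, s'.timer = .running now T ∧ s'.round ≤ T ∧ s'.pos = s'.phaseStart ∧ s'.Timed) := by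
  cases h
  case new4 hT' =>
    cases gr <;> simp_all [LocalState.Timed, LocalState.phaseStart, LocalState.pos]
  all_goals
    simp_all [LocalState.nextRound, LocalState.Timed, LocalState.phaseStart, LocalState.pos]

end LocalStep

/-! ### Progress, measured by an arbitrary clock -/

/-- `P` holds in some configuration after the `k`-th one that is reached within `d` units of length
`D` of the clock `clk`. -/
def Within (clk : ℕ → ℝ) (D : ℝ) (d k : ℕ) (P : ℕ → Prop) : Prop :=
  ∃ k' ≥ k, clk k' ≤ clk k + d * D ∧ P k'

namespace Within

variable {clk : ℕ → ℝ} {D : ℝ} {d d' k : ℕ} {P Q : ℕ → Prop}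

theorem of_self (hD : 0 ≤ D) (h : P k) : Within clk D d k P :=
  ⟨k, le_rfl, by have : (0 : ℝ) ≤ d * D := by positivity
                 linarith, h⟩

theorem trans (h : Within clk D d k P) (h' : ∀ k' ≥ k, P k' → Within clk D d' k' Q) :
    Within clk D (d + d') k Q := by
  obtain ⟨k1, hk1, hc1, hP⟩ := h
  obtain ⟨k2, hk2, hc2, hQ⟩ := h' k1 hk1 hP
  refine ⟨k2, hk1.trans hk2, ?_, hQ⟩
  push_cast
  linarith

theorem imp (h : Within clk D d k P) (h' : ∀ k' ≥ k, P k' → Q k') : Within clk D d k Q := by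
  obtain ⟨k1, hk1, hc1, hP⟩ := h
  exact ⟨k1, hk1, hc1, h' k1 hk1 hP⟩

/-- Finitely many stable properties hold together as soon as the last of them does. -/
theorem forall_fin {ι : Type*} [Finite ι] (hD : 0 ≤ D) {P : ι → ℕ → Prop}
    (hP : ∀ i, Monotone (P i)) (h : ∀ i, Within clk D d k (P i)) :
    Within clk D d k (fun k' => ∀ i, P i k') := by
  choose f hf1 hf2 hf3 using h
  cases nonempty_fintype ι
  rcases isEmpty_or_nonempty ι with hι | hι
  · exact of_self hD fun i => isEmptyElim i
  · obtain ⟨i₀, -, hi₀⟩ := Finset.exists_max_image Finset.univ f Finset.univ_nonempty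
    exact ⟨f i₀, hf1 i₀, hf2 i₀, fun i => hP i (hi₀ i (Finset.mem_univ i)) (hf3 i)⟩

theorem forall_correct {n : ℕ} {faulty : Finset (Fin n)} (hD : 0 ≤ D)
    {P : Fin n → ℕ → Prop} (hP : ∀ i ∉ faulty, Monotone (P i))
    (h : ∀ i ∉ faulty, Within clk D d k (P i)) :
    Within clk D d k (fun k' => ∀ i ∉ faulty, P i k') :=
  forall_fin (P := fun i k' => i ∉ faulty → P i k') hD
    (fun i _ _ hkk hp hi => hP i hi hkk (hp hi)) fun i => by
      by_cases hi : i ∈ faulty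
      · exact of_self hD fun h => absurd hi h
      · exact (h i hi).imp fun _ _ hp _ => hp

theorem and (h : Within clk D d k P) (h' : Within clk D d k Q) (hP : Monotone P)
    (hQ : Monotone Q) : Within clk D d k (fun k' => P k' ∧ Q k') := by
  obtain ⟨k1, hk1, hc1, hP1⟩ := h
  obtain ⟨k2, hk2, hc2, hQ2⟩ := h'
  rcases le_total k1 k2 with hle | hle
  · exact ⟨k2, hk2, hc2, hP hle hP1, hQ2⟩
  · exact ⟨k1, hk1, hc1, hP1, hQ hle hQ2⟩

end Within

namespace Execution

variable {n t : ℕ} {sr : StartRule} {gr : GrowthRule} {faulty : Finset (Fin n)}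
  {x : Fin n → Bool} (e : Execution n t sr gr faulty x)

/-! ### Executions seen from one correct process -/

/-- The local state of process `i` in the `k`-th configuration. -/
abbrev st (k : ℕ) (i : Fin n) : LocalState n := (e.cfg k).loc i

/-- One step of the system, seen from the correct process `i`: either `i` at most receives a message
or sees its timer expire, or `i` executes an action. -/
theorem step_cases {i : Fin n} (hi : i ∉ faulty) (k : ℕ) :
    (∃ rcv timer, e.st (k + 1) i = { e.st k i with rcv := rcv, timer := timer } ∧
        (e.st k i).rcv ⊆ rcv ∧
        (∀ j m, (j, m) ∈ rcv → (j, m) ∈ (e.st k i).rcv ∨ (j, i, m) ∈ (e.cfg k).sent) ∧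
        (timer = (e.st k i).timer ∨
          ∃ since T, (e.st k i).timer = .running since T ∧ timer = .expired) ∧
        ∀ j m, (i, j, m) ∈ (e.cfg (k + 1)).sent ↔ (i, j, m) ∈ (e.cfg k).sent) ∨
      ∃ a out, LocalStep t sr gr (x i) i (e.time (k + 1)) a (e.st k i) (e.st (k + 1) i) out ∧
        ∀ j m, (i, j, m) ∈ (e.cfg (k + 1)).sent ↔ (i, j, m) ∈ (e.cfg k).sent ∨ m ∈ out := by
  have h := e.step k
  unfold st
  generalize e.cfg k = c at h ⊢
  generalize e.cfg (k + 1) = c' at h ⊢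
  cases h with
  | stutter => exact .inl ⟨_, _, rfl, subset_rfl, fun _ _ h => .inl h, .inl rfl, fun _ _ => .rfl⟩
  | receive p q m hm =>
    by_cases hq : i = q
    · subst hq
      refine .inl ⟨insert (p, m) (c.loc i).rcv, (c.loc i).timer, by simp, Set.subset_insert _ _,
        fun j m' h => ?_, .inl rfl, fun _ _ => .rfl⟩
      rcases h with h | h
      · cases h; exact .inr hm
      · exact .inl h
    · refine .inl ⟨(c.loc i).rcv, (c.loc i).timer, by simp [Function.update_of_ne hq], subset_rfl,
        fun _ _ h => .inl h, .inl rfl, fun _ _ => .rfl⟩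
  | act p a s' out hp h =>
    by_cases hq : i = p
    · subst hq
      refine .inr ⟨a, out, by simpa using h, by simp⟩
    · refine .inl ⟨(c.loc i).rcv, (c.loc i).timer, by simp [Function.update_of_ne hq], subset_rfl,
        fun _ _ h => .inl h, .inl rfl, by simp [hq]⟩
  | expire p since T hp h =>
    by_cases hq : i = p
    · subst hq
      exact .inl ⟨(c.loc i).rcv, .expired, by simp, subset_rfl,
        fun _ _ h => .inl h, .inr ⟨_, _, h, rfl⟩, fun _ _ => .rfl⟩
    · refine .inl ⟨(c.loc i).rcv, (c.loc i).timer, by simp [Function.update_of_ne hq], subset_rfl,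
        fun _ _ h => .inl h, .inl rfl, fun _ _ => .rfl⟩
  | byzantine p q m hp =>
    have hq : i ≠ p := fun h => hi (h ▸ hp)
    refine .inl ⟨(c.loc i).rcv, (c.loc i).timer, rfl, subset_rfl,
        fun _ _ h => .inl h, .inl rfl, by simp [hq]⟩

theorem st_zero (i : Fin n) : e.st 0 i = LocalState.initial n := by
  simp [st, e.cfg_zero, Config.initial]

theorem sent_zero : (e.cfg 0).sent = ∅ := by
  simp [e.cfg_zero, Config.initial]

theorem sent_mono {k k' : ℕ} (h : k ≤ k') : (e.cfg k).sent ⊆ (e.cfg k').sent := by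
  induction h with
  | refl => exact subset_rfl
  | @step k' _ ih =>
    refine ih.trans ?_
    have h := e.step k'
    generalize e.cfg k' = c at h ⊢
    generalize e.cfg (k' + 1) = c' at h ⊢
    cases h <;> simp

variable {e}

section

variable {i : Fin n} (hi : i ∉ faulty)
include hi

theorem idle_round (k : ℕ) : (e.st k i).pc = .idle → (e.st k i).round = 0 := by
  induction k with
  | zero => simp [st_zero, LocalState.initial]
  | succ k ih =>
    rcases e.step_cases hi k with ⟨_, _, h, _⟩ | ⟨a, out, h, _⟩
    · simpa [h] using ih
    · exact fun hpc => absurd hpc h.pc_ne_idle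

theorem one_le_round (k : ℕ) : (e.st k i).pc ≠ .idle → 1 ≤ (e.st k i).round := by
  induction k with
  | zero => simp [st_zero, LocalState.initial]
  | succ k ih =>
    rcases e.step_cases hi k with ⟨_, _, h, _⟩ | ⟨a, out, h, _⟩
    · simpa [h] using ih
    · exact fun _ => h.one_le_round ih

theorem grows_succ (k : ℕ) : (e.st k i).Grows (e.st (k + 1) i) := by
  rcases e.step_cases hi k with ⟨_, _, h, hr, _, ht, _⟩ | ⟨a, out, h, _⟩
  · rw [h]
    refine ⟨le_rfl, le_rfl, hr, fun _ _ h => h, subset_rfl, fun _ _ => rfl, fun _ => ?_,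
      fun _ => rfl⟩
    rcases ht with ht | ⟨_, _, _, ht⟩
    · exact .inl ht
    · exact .inr ht
  · exact h.grows (e.idle_round hi k)

theorem pc_ne_idle_mono {k k' : ℕ} (h : k ≤ k') (hk : (e.st k i).pc ≠ .idle) :
    (e.st k' i).pc ≠ .idle := by
  induction h with
  | refl => exact hk
  | @step k' _ ih =>
    rcases e.step_cases hi k' with ⟨_, _, h, _⟩ | ⟨a, out, h, _⟩
    · simpa [h] using ih
    · exact h.pc_ne_idle

theorem grows {k k' : ℕ} (h : k ≤ k') : (e.st k i).Grows (e.st k' i) := by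
  induction h with
  | refl => exact .refl _
  | @step k' hk ih => exact ih.trans (e.pc_ne_idle_mono hi hk) (e.grows_succ hi k')

theorem pos_mono {k k' : ℕ} (h : k ≤ k') : (e.st k i).pos ≤ (e.st k' i).pos :=
  (e.grows hi h).pos_le

theorem le_pos_of_le_round {k r : ℕ} (h : r ≤ (e.st k i).round) : 5 * r ≤ (e.st k i).pos :=
  LocalState.le_pos_of_round (e.idle_round hi k) h

theorem sent_of_rcv {k : ℕ} {j : Fin n} {m : Msg} (h : (j, m) ∈ (e.st k i).rcv) :
    (j, i, m) ∈ (e.cfg k).sent := by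
  induction k with
  | zero => simp [st_zero, LocalState.initial] at h
  | succ k ih =>
    refine e.sent_mono (Nat.le_succ k) ?_
    rcases e.step_cases hi k with ⟨_, _, hs, _, hr, _⟩ | ⟨a, out, hs, _⟩
    · rw [hs] at h
      rcases hr j m h with h | h
      · exact ih h
      · exact h
    · rw [hs.rcv_eq] at h
      exact ih h

/-- A correct process that has passed a position has arrived there by executing an action. -/
theorem exists_cross {k p : ℕ} (hp : 1 ≤ p) (h : p ≤ (e.st k i).pos) :
    ∃ k' < k, (e.st k' i).pos < p ∧ p ≤ (e.st (k' + 1) i).pos ∧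
      ∃ a out, LocalStep t sr gr (x i) i (e.time (k' + 1)) a (e.st k' i) (e.st (k' + 1) i) out ∧
        ∀ j, ∀ m ∈ out, (i, j, m) ∈ (e.cfg (k' + 1)).sent := by
  induction k with
  | zero => simp [st_zero, LocalState.initial, LocalState.pos] at h; omega
  | succ k ih =>
    by_cases hk : p ≤ (e.st k i).pos
    · obtain ⟨k', hk', h'⟩ := ih hk
      exact ⟨k', by omega, h'⟩
    · refine ⟨k, by omega, by omega, h, ?_⟩
      rcases e.step_cases hi k with ⟨_, _, hs, _⟩ | ⟨a, out, hs, hm⟩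
      · rw [hs] at h
        exact absurd h hk
      · exact ⟨a, out, hs, fun j m hj => (hm j m).2 (.inr hj)⟩

/-! ### What correct processes have sent -/

theorem est_sent_iff {k : ℕ} {j : Fin n} {r : ℕ} {v : Bool} :
    (i, j, Msg.est r v) ∈ (e.cfg k).sent ↔ (r, v) ∈ (e.st k i).bcast := by
  induction k with
  | zero => simp [st_zero, LocalState.initial, sent_zero]
  | succ k ih =>
    rcases e.step_cases hi k with ⟨_, _, hs, _, _, _, hm⟩ | ⟨a, out, hs, hm⟩
    · rw [hm, ih, hs]
    · rw [hm, ih, hs.bcast_iff]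

theorem exists_coord_step {k : ℕ} {j : Fin n} {r : ℕ} {w : Bool}
    (h : (i, j, Msg.coord r w) ∈ (e.cfg k).sent) :
    ∃ k' < k, (e.st k' i).pos = 5 * r + 1 ∧ (e.st (k' + 1) i).pos = 5 * r + 2 ∧
      ((e.st k' i).bin r).head? = some w := by
  induction k with
  | zero => simp [sent_zero] at h
  | succ k ih =>
    rcases e.step_cases hi k with ⟨_, _, hs, _, _, _, hm⟩ | ⟨a, out, hs, hm⟩
    · obtain ⟨k', hk', h'⟩ := ih ((hm _ _).1 h)
      exact ⟨k', by omega, h'⟩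
    · rcases (hm _ _).1 h with h | h
      · obtain ⟨k', hk', h'⟩ := ih h
        exact ⟨k', by omega, h'⟩
      · exact ⟨k, by omega, hs.coord_out h⟩

theorem exists_aux_step {k : ℕ} {j : Fin n} {r : ℕ} {A : Finset Bool}
    (h : (i, j, Msg.aux r A) ∈ (e.cfg k).sent) :
    ∃ k' < k, (e.st k' i).pos = 5 * r + 2 ∧ (e.st (k' + 1) i).pos = 5 * r + 3 ∧
      (e.st k' i).bin r ≠ [] ∧ (e.st k' i).NewAux A ∧ (e.st (k' + 1) i).aux = A := by
  induction k with
  | zero => simp [sent_zero] at h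
  | succ k ih =>
    rcases e.step_cases hi k with ⟨_, _, hs, _, _, _, hm⟩ | ⟨a, out, hs, hm⟩
    · obtain ⟨k', hk', h'⟩ := ih ((hm _ _).1 h)
      exact ⟨k', by omega, h'⟩
    · rcases (hm _ _).1 h with h | h
      · obtain ⟨k', hk', h'⟩ := ih h
        exact ⟨k', by omega, h'⟩
      · exact ⟨k, by omega, hs.aux_out h⟩

/-- A process moves past a position only once. -/
theorem cross_unique {k k' p : ℕ} (h1 : (e.st k i).pos < p) (h2 : p ≤ (e.st (k + 1) i).pos)
    (h1' : (e.st k' i).pos < p) (h2' : p ≤ (e.st (k' + 1) i).pos) : k = k' := by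
  by_contra hne
  rcases Nat.lt_or_gt_of_ne hne with h | h
  · have := e.pos_mono hi (show k + 1 ≤ k' from h); omega
  · have := e.pos_mono hi (show k' + 1 ≤ k from h); omega

theorem coord_unique {k k' : ℕ} {j j' : Fin n} {r : ℕ} {w w' : Bool}
    (h : (i, j, Msg.coord r w) ∈ (e.cfg k).sent)
    (h' : (i, j', Msg.coord r w') ∈ (e.cfg k').sent) : w = w' := by
  obtain ⟨k, _, h1, h2, h3⟩ := e.exists_coord_step hi h
  obtain ⟨k', _, h1', h2', h3'⟩ := e.exists_coord_step hi h'
  obtain rfl := e.cross_unique hi (p := 5 * r + 2) (by omega) h2.ge (by omega) h2'.ge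
  simpa [h3] using h3'

theorem aux_unique {k k' : ℕ} {j j' : Fin n} {r : ℕ} {A A' : Finset Bool}
    (h : (i, j, Msg.aux r A) ∈ (e.cfg k).sent)
    (h' : (i, j', Msg.aux r A') ∈ (e.cfg k').sent) : A = A' := by
  obtain ⟨k, _, h1, h2, _, _, h3⟩ := e.exists_aux_step hi h
  obtain ⟨k', _, h1', h2', _, _, h3'⟩ := e.exists_aux_step hi h'
  obtain rfl := e.cross_unique hi (p := 5 * r + 3) (by omega) h2.ge (by omega) h2'.ge
  rw [← h3, ← h3']

theorem aux_nonempty {k : ℕ} {j : Fin n} {r : ℕ} {A : Finset Bool}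
    (h : (i, j, Msg.aux r A) ∈ (e.cfg k).sent) : A.Nonempty := by
  obtain ⟨k', _, h1, _, h2, h3, _⟩ := e.exists_aux_step hi h
  exact h3.nonempty (by rwa [(LocalState.pos_m05 h1).2])

theorem aux_subset_bin {k : ℕ} {j : Fin n} {r : ℕ} {A : Finset Bool}
    (h : (i, j, Msg.aux r A) ∈ (e.cfg k).sent) : ∀ v ∈ A, v ∈ (e.st k i).bin r := by
  obtain ⟨k', hk, h1, _, h2, h3, _⟩ := e.exists_aux_step hi h
  intro v hv
  have := h3.subset hv
  rw [(LocalState.pos_m05 h1).2, List.mem_toFinset] at this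
  exact (e.grows hi hk.le).bin _ _ this

/-- The variable `aux` of a process that waits at New4 or M-07 is the content of the `AUX` message it
has sent. -/
theorem aux_sent {k : ℕ} (hpc : (e.st k i).pc = .new4 ∨ (e.st k i).pc = .m07) (j : Fin n) :
    (i, j, Msg.aux (e.st k i).round (e.st k i).aux) ∈ (e.cfg k).sent := by
  induction k with
  | zero => simp [st_zero, LocalState.initial] at hpc
  | succ k ih =>
    rcases e.step_cases hi k with ⟨_, _, hs, _, _, _, hm⟩ | ⟨a, out, hs, hm⟩
    · rw [hs] at hpc ⊢
      exact (hm _ _).2 (ih hpc)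
    · rcases hs.aux_cases hpc with ⟨h1, h2, h3⟩ | h
      · rw [h2, h3]
        exact (hm _ _).2 (.inl (ih h1))
      · exact (hm _ _).2 (.inr h)

theorem exists_bcast {k r : ℕ} (hr : 1 ≤ r) (h : 5 * r ≤ (e.st k i).pos) :
    ∃ v, (r, v) ∈ (e.st k i).bcast := by
  obtain ⟨k', hk', h1, h2, a, out, hs, _⟩ := e.exists_cross hi (by omega) h
  obtain ⟨_, h3⟩ := hs.cross_new (e.idle_round hi k') hr h1 h2
  exact ⟨_, (e.grows hi (show k' + 1 ≤ k from hk')).bcast h3⟩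

theorem exists_coord {k r : ℕ} (hr : 1 ≤ r) (h : 5 * r + 2 ≤ (e.st k i).pos) (hc : IsCoord i r) :
    ∃ w, w ∈ (e.st k i).bin r ∧ ∀ j, (i, j, Msg.coord r w) ∈ (e.cfg k).sent := by
  obtain ⟨k', hk', h1, h2, a, out, hs, hm⟩ := e.exists_cross hi (by omega) h
  obtain ⟨_, h3⟩ := hs.cross_new2 (e.idle_round hi k') hr h1 h2
  obtain ⟨w, hw, h4⟩ := h3 hc
  exact ⟨w, (e.grows hi hk'.le).bin _ _ hw, fun j => e.sent_mono hk' (hm j _ h4)⟩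

theorem exists_aux {k r : ℕ} (hr : 1 ≤ r) (h : 5 * r + 3 ≤ (e.st k i).pos) :
    ∃ A, ∀ j, (i, j, Msg.aux r A) ∈ (e.cfg k).sent := by
  obtain ⟨k', hk', h1, h2, a, out, hs, hm⟩ := e.exists_cross hi (by omega) h
  obtain ⟨_, _, _, A, _, h4⟩ := hs.cross_m05 (e.idle_round hi k') hr h1 h2
  exact ⟨A, fun j => e.sent_mono hk' (hm j _ h4)⟩

theorem bin_senders {k r : ℕ} {v : Bool} (h : v ∈ (e.st k i).bin r) :
    2 * t + 1 ≤ (e.st k i).numSenders (fun m => m = .est r v) := by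
  induction k with
  | zero => simp [st_zero, LocalState.initial] at h
  | succ k ih =>
    refine le_trans ?_ (LocalState.numSenders_mono (e.grows_succ hi k).rcv _)
    rcases e.step_cases hi k with ⟨_, _, hs, _⟩ | ⟨a, out, hs, _⟩
    · rw [hs] at h
      exact ih h
    · rcases hs.bin_cases h with h | h
      · exact ih h
      · exact h

/-- A correct process that has left round `r` has waited for its timer (or caught up), and its
next estimate and a possible decision come from its set `values`. -/
theorem exists_m07_step {k r : ℕ} (hr : 1 ≤ r) (h : r + 1 ≤ (e.st k i).round) :
    ∃ k' < k, (e.st k' i).pos = 5 * r + 4 ∧ 5 * (r + 1) ≤ (e.st (k' + 1) i).pos ∧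
      ∃ V, (e.st k' i).Values t V ∧
      ((∃ v, V = {v} ∧ ((e.st k i).round = r + 1 → (e.st k i).est = v) ∧
          (v = roundBit r → (e.st k i).decided ≠ none)) ∨
        (V = {false, true} ∧ ((e.st k i).round = r + 1 → (e.st k i).est = roundBit r))) := by
  obtain ⟨k', hk', h1, h2, a, out, hs, hm⟩ :=
    e.exists_cross hi (by omega) (e.le_pos_of_le_round hi h)
  obtain ⟨h3, h4, _, V, hV, h5⟩ := hs.cross_m07 (e.idle_round hi k') hr h1 h2
  have hround := (LocalState.pos_new1 (by omega) h4)
  have hg := e.grows hi (show k' + 1 ≤ k from hk')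
  have hest : (e.st k i).round = r + 1 → (e.st k i).est = (e.st (k' + 1) i).est := fun h =>
    hg.est (by simp [hround.1]) (by rw [hround.2, h])
  refine ⟨k', hk', h3, h2, V, hV, ?_⟩
  rcases h5 with ⟨v, rfl, hv, hd⟩ | ⟨rfl, hv⟩
  · refine .inl ⟨v, rfl, fun h => (hest h).trans hv, fun h => ?_⟩
    rw [hg.decided (hd h)]
    exact hd h
  · exact .inr ⟨rfl, fun h => (hest h).trans hv⟩

theorem est_one {k : ℕ} (h : (e.st k i).round = 1) : (e.st k i).est = x i := by
  induction k with
  | zero => simp [st_zero, LocalState.initial] at h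
  | succ k ih =>
    rcases e.step_cases hi k with ⟨_, _, hs, _⟩ | ⟨a, out, hs, _⟩
    · rw [hs] at h ⊢
      exact ih h
    · rcases hs.round_cases (e.idle_round hi k) with h1 | ⟨_, _, h1⟩ | ⟨h1, h2⟩
      · rw [(e.grows_succ hi k).est _ h1.symm, ih (by omega)]
        intro hpc
        have := e.idle_round hi k hpc
        omega
      · exact h1
      · have := e.one_le_round hi k (by simp [h1])
        omega

theorem exists_decision {k : ℕ} {v : Bool} (h : (e.st k i).decided = some v) :
    ∃ k' < k, (e.st k' i).pc = .m07 ∧ v = roundBit (e.st k' i).round ∧ (e.st k' i).Values t {v} := by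
  induction k with
  | zero => simp [st_zero, LocalState.initial] at h
  | succ k ih =>
    rcases e.step_cases hi k with ⟨_, _, hs, _⟩ | ⟨a, out, hs, _⟩
    · rw [hs] at h
      obtain ⟨k', hk', h'⟩ := ih h
      exact ⟨k', by omega, h'⟩
    · rcases hs.decided_cases h with h | h
      · obtain ⟨k', hk', h'⟩ := ih h
        exact ⟨k', by omega, h'⟩
      · exact ⟨k, by omega, h⟩

end

/-! ### Validity and agreement -/

/-- BV-justification: a value that a correct process has BV-broadcast or echoed in round `r` was
before the estimate of some correct process in round `r`. -/
theorem est_justified (hf : faulty.card ≤ t) {k : ℕ} {i : Fin n} (hi : i ∉ faulty) {r : ℕ}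
    {v : Bool} (h : (r, v) ∈ (e.st k i).bcast) :
    1 ≤ r ∧ ∃ p ∉ faulty, ∃ k' ≤ k, (e.st k' p).round = r ∧ (e.st k' p).est = v := by
  induction k generalizing i with
  | zero => simp [st_zero, LocalState.initial] at h
  | succ k ih =>
    have key : (r, v) ∈ (e.st k i).bcast →
        1 ≤ r ∧ ∃ p ∉ faulty, ∃ k' ≤ k + 1, (e.st k' p).round = r ∧ (e.st k' p).est = v := by
      intro h
      obtain ⟨hr, p, hp, k', hk', h'⟩ := ih hi h
      exact ⟨hr, p, hp, k', by omega, h'⟩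
    rcases e.step_cases hi k with ⟨_, _, hs, _⟩ | ⟨a, out, hs, _⟩
    · rw [hs] at h
      exact key h
    · rcases (hs.bcast_iff _ _).1 h with h | h
      · exact key h
      · rcases hs.est_out h with ⟨h1, h2, h3⟩ | h
        · exact ⟨h1, i, hi, k + 1, le_rfl, h2, h3⟩
        · obtain ⟨j, hj, m, rfl, hm⟩ := LocalState.exists_correct_sender hf h
          obtain ⟨hr, p, hp, k', hk', h'⟩ := ih hj ((est_sent_iff hj).1 (sent_of_rcv hi hm))
          exact ⟨hr, p, hp, k', by omega, h'⟩

theorem bin_justified (hf : faulty.card ≤ t) {k : ℕ} {i : Fin n} (hi : i ∉ faulty) {r : ℕ}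
    {v : Bool} (h : v ∈ (e.st k i).bin r) :
    1 ≤ r ∧ ∃ p ∉ faulty, ∃ k' ≤ k, (e.st k' p).round = r ∧ (e.st k' p).est = v := by
  obtain ⟨j, hj, m, rfl, hm⟩ := LocalState.exists_correct_sender hf
    (show t + 1 ≤ _ from le_trans (by omega) (bin_senders hi h))
  exact est_justified hf hj ((est_sent_iff hj).1 (sent_of_rcv hi hm))

/-- Every correct process that is in round `r` has the estimate `v`. -/
def Unanimous (e : Execution n t sr gr faulty x) (r : ℕ) (v : Bool) : Prop :=
  ∀ i ∉ faulty, ∀ k, (e.st k i).round = r → (e.st k i).est = v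

theorem Unanimous.values_eq (hf : faulty.card ≤ t) {r : ℕ} {v : Bool} (h : e.Unanimous r v)
    {k : ℕ} {i : Fin n} (hi : i ∉ faulty) (hr : (e.st k i).round = r) {V : Finset Bool}
    (hV : (e.st k i).ValuesOK t V) : V = {v} := by
  refine Finset.eq_singleton_iff_nonempty_unique_mem.2 ⟨hV.1, fun u hu => ?_⟩
  have hu := hV.2.1 hu
  rw [List.mem_toFinset, hr] at hu
  obtain ⟨_, p, hp, k', _, h1, h2⟩ := bin_justified hf hi hu
  rw [← h2, h p hp k' h1]

theorem Unanimous.succ (hf : faulty.card ≤ t) {r : ℕ} (hr : 1 ≤ r) {v : Bool}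
    (h : e.Unanimous r v) : e.Unanimous (r + 1) v := by
  intro i hi k hk
  obtain ⟨k', _, h1, _, V, hV, h2⟩ := exists_m07_step hi hr hk.ge
  have hV' := h.values_eq hf hi (LocalState.pos_m07 h1).2 hV.1
  rcases h2 with ⟨u, rfl, h2, _⟩ | ⟨rfl, _⟩
  · rw [h2 hk]
    simpa using hV'
  · exact absurd hV' (by clear * -; revert v; decide)

theorem Unanimous.of_le (hf : faulty.card ≤ t) {r r' : ℕ} (hr : 1 ≤ r) {v : Bool}
    (h : e.Unanimous r v) (hrr : r ≤ r') : e.Unanimous r' v := by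
  induction hrr with
  | refl => exact h
  | @step r' hr' ih => exact ih.succ hf (hr.trans hr')

/-- Two quorums of `AUX` messages of one round have a correct sender in common, so the sets that
qualify as `values` intersect. -/
theorem values_inter (ht : 3 * t < n) (hf : faulty.card ≤ t) {k k' : ℕ} {i i' : Fin n}
    (hi : i ∉ faulty) (hi' : i' ∉ faulty) (hr : (e.st k i).round = (e.st k' i').round)
    {V V' : Finset Bool} (hV : (e.st k i).ValuesOK t V) (hV' : (e.st k' i').ValuesOK t V') :
    ∃ u ∈ V, u ∈ V' := by
  obtain ⟨_, _, Q, b, hQ, hb, rfl⟩ := hV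
  obtain ⟨_, _, Q', b', hQ', hb', rfl⟩ := hV'
  obtain ⟨q, hq⟩ : ((Q ∩ Q') \ faulty).Nonempty := by
    rw [← Finset.card_pos]
    have h1 := Finset.le_card_sdiff faulty (Q ∩ Q')
    have h2 := Finset.card_union_add_card_inter Q Q'
    have h3 := Finset.card_le_univ (Q ∪ Q')
    rw [Fintype.card_fin] at h3
    omega
  simp only [Finset.mem_sdiff, Finset.mem_inter] at hq
  obtain ⟨⟨hq1, hq2⟩, hqf⟩ := hq
  have h1 := sent_of_rcv hi (hb q hq1)
  have h2 := sent_of_rcv hi' (hb' q hq2)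
  rw [← hr] at h2
  obtain ⟨u, hu⟩ := aux_nonempty hqf h1
  refine ⟨u, Finset.mem_biUnion.2 ⟨q, hq1, hu⟩, Finset.mem_biUnion.2 ⟨q, hq2, ?_⟩⟩
  rwa [← aux_unique hqf h1 h2]

/-- If a correct process can decide `v` in round `r`, then all correct processes enter the next
round with the estimate `v`. -/
theorem unanimous_of_values (ht : 3 * t < n) (hf : faulty.card ≤ t) {k : ℕ} {i : Fin n}
    (hi : i ∉ faulty) (hr : 1 ≤ (e.st k i).round)
    (hV : (e.st k i).Values t {roundBit (e.st k i).round}) :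
    e.Unanimous ((e.st k i).round + 1) (roundBit (e.st k i).round) := by
  intro j hj l hl
  obtain ⟨k', _, h1, _, V, hV', h2⟩ := exists_m07_step hj hr hl.ge
  rcases h2 with ⟨u, rfl, h2, _⟩ | ⟨rfl, h2⟩
  · obtain ⟨w, hw, hw'⟩ := values_inter ht hf hi hj (LocalState.pos_m07 h1).2.symm hV.1 hV'.1
    rw [Finset.mem_singleton] at hw hw'
    rw [h2 hl, ← hw', hw]
  · exact h2 hl

theorem agreement_holds (ht : 3 * t < n) (hf : faulty.card ≤ t) : e.Agreement := by
  have key : ∀ i ∉ faulty, ∀ j ∉ faulty, ∀ k l v w,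
      (e.st k i).pc = .m07 → v = roundBit (e.st k i).round → (e.st k i).Values t {v} →
      (e.st l j).pc = .m07 → w = roundBit (e.st l j).round → (e.st l j).Values t {w} →
      (e.st k i).round ≤ (e.st l j).round → v = w := by
    intro i hi j hj k l v w h1 h2 h3 h1' h2' h3' hle
    rcases hle.eq_or_lt with h | h
    · rw [h2, h2', h]
    · subst h2
      have hr := one_le_round (e := e) hi k (by simp [h1])
      have h4 := (unanimous_of_values ht hf hi hr h3).of_le hf (by omega) h
      simpa using (h4.values_eq hf hj rfl h3'.1).symm
  intro i hi j hj k l v w hv hw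
  obtain ⟨k', _, h1, h2, h3⟩ := exists_decision hi hv
  obtain ⟨l', _, h1', h2', h3'⟩ := exists_decision hj hw
  rcases le_total (e.st k' i).round (e.st l' j).round with h | h
  · exact key i hi j hj k' l' v w h1 h2 h3 h1' h2' h3' h
  · exact (key j hj i hi l' k' w v h1' h2' h3' h1 h2 h3 h).symm

theorem est_proposed (hf : faulty.card ≤ t) {r : ℕ} (hr : 1 ≤ r) {i : Fin n} (hi : i ∉ faulty)
    {k : ℕ} (h : (e.st k i).round = r) : ∃ j ∉ faulty, x j = (e.st k i).est := by
  induction r, hr using Nat.le_induction generalizing i k with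
  | base => exact ⟨i, hi, (est_one hi h).symm⟩
  | succ r hr ih =>
    obtain ⟨k', _, h1, _, V, hV, h2⟩ := exists_m07_step hi hr h.ge
    have hmem : (e.st k i).est ∈ V := by
      rcases h2 with ⟨u, rfl, h2, _⟩ | ⟨rfl, h2⟩
      · simp [h2 h]
      · rw [h2 h]; cases roundBit r <;> simp
    have h3 := hV.1.2.1 hmem
    rw [List.mem_toFinset, (LocalState.pos_m07 h1).2] at h3
    obtain ⟨_, p, hp, l, _, h4, h5⟩ := bin_justified hf hi h3
    rw [← h5]
    exact ih hp h4

theorem validity_holds (hf : faulty.card ≤ t) : e.Validity := by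
  intro i hi k v hv
  obtain ⟨k', _, _, _, h3⟩ := exists_decision hi hv
  have h4 := h3.1.2.1 (Finset.mem_singleton_self v)
  rw [List.mem_toFinset] at h4
  obtain ⟨hr, p, hp, l, _, h5, rfl⟩ := bin_justified hf hi h4
  exact est_proposed hf hr hp h5

/-- Once the correct processes are unanimous, they decide as soon as the bit of the round is the
common estimate, provided that they all go through the rounds. -/
theorem termination_of_unanimous (hf : faulty.card ≤ t)
    (hprog : ∀ i ∉ faulty, ∀ r, ∃ k, r ≤ (e.st k i).round) {r : ℕ} (hr : 1 ≤ r) {v : Bool}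
    (h : e.Unanimous r v) : e.Termination := by
  obtain ⟨s, hs, hsv⟩ : ∃ s, r ≤ s ∧ v = roundBit s := by
    by_cases hv : v = roundBit r
    · exact ⟨r, le_rfl, hv⟩
    · refine ⟨r + 1, by omega, ?_⟩
      have : roundBit (r + 1) = !roundBit r := by
        simp only [roundBit]
        rcases Nat.mod_two_eq_zero_or_one r with h | h <;> simp [Nat.add_mod, h]
      rw [this]
      revert hv
      cases v <;> cases roundBit r <;> simp
  intro i hi
  obtain ⟨k, hk⟩ := hprog i hi (s + 1)
  obtain ⟨k', _, h1, _, V, hV, h2⟩ := exists_m07_step hi (hr.trans hs) hk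
  have hV' := (h.of_le hf hr hs).values_eq hf hi (LocalState.pos_m07 h1).2 hV.1
  rcases h2 with ⟨u, rfl, _, h2⟩ | ⟨rfl, _⟩
  · rw [Finset.singleton_inj] at hV'
    obtain ⟨w, hw⟩ := Option.ne_none_iff_exists'.1 (h2 (hV'.trans hsv))
    exact ⟨k, w, hw⟩
  · exact absurd hV' (by clear * -; revert v; decide)

/-! ### Progress in bounded time -/

theorem card_correct (hf : faulty.card ≤ t) : n - t ≤ (faultyᶜ).card := by
  rw [Finset.card_compl, Fintype.card_fin]
  omega

/-- From the `k₀`-th configuration on, new messages are delivered and actions executed within one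
unit of the clock; no correct process has reached round `R` in that configuration, so that the
messages of later rounds are new.  With the clock that stands still this is plain asynchronous
reliability, with the real clock it is eventual synchrony; the progress of the algorithm thus
has to be analysed only once. -/
structure Paced (e : Execution n t sr gr faulty x) (clk : ℕ → ℝ) (D : ℝ) (k₀ R : ℕ) : Prop where
  nonneg : 0 ≤ D
  one_le : 1 ≤ R
  round_lt : ∀ i ∉ faulty, (e.st k₀ i).round < R
  deliver : ∀ i ∉ faulty, ∀ j ∉ faulty, ∀ m, ∀ k ≥ k₀, (i, j, m) ∉ (e.cfg k₀).sent →
    (i, j, m) ∈ (e.cfg k).sent → Within clk D 1 k (fun k' => (i, m) ∈ (e.st k' j).rcv)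
  act : ∀ i ∉ faulty, ∀ a, a ≠ Action.start → ∀ k ≥ k₀,
    Enabled t sr gr (x i) i a (e.st k i) →
      Within clk D 1 k (fun k' => ¬ Enabled t sr gr (x i) i a (e.st k' i))

theorem monotone_bin {i : Fin n} (hi : i ∉ faulty) (r : ℕ) (v : Bool) :
    Monotone (fun k => v ∈ (e.st k i).bin r) :=
  fun _ _ h hp => (grows hi h).bin r v hp

theorem monotone_bcast {i : Fin n} (hi : i ∉ faulty) (p : ℕ × Bool) :
    Monotone (fun k => p ∈ (e.st k i).bcast) :=
  fun _ _ h hp => (grows hi h).bcast hp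

theorem monotone_pos {i : Fin n} (hi : i ∉ faulty) (p : ℕ) :
    Monotone (fun k => p ≤ (e.st k i).pos) :=
  fun _ _ h hp => hp.trans (pos_mono hi h)

theorem bin_ne_nil_mono {i : Fin n} (hi : i ∉ faulty) {r k k' : ℕ} (h : k ≤ k')
    (hk : (e.st k i).bin r ≠ []) : (e.st k' i).bin r ≠ [] := by
  obtain ⟨v, hv⟩ := List.exists_mem_of_ne_nil _ hk
  exact List.ne_nil_of_mem ((grows hi h).bin r v hv)

/-- While a process stays at its position, its timer stays done. -/
theorem timerDone_mono {i : Fin n} (hi : i ∉ faulty) {k k' : ℕ} (h : k ≤ k')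
    (hpc : (e.st k' i).pc = (e.st k i).pc) (hr : (e.st k' i).round = (e.st k i).round)
    (hd : (e.st k i).TimerDone t) : (e.st k' i).TimerDone t := by
  have hg := grows (e := e) hi h
  rcases hd with hd | ⟨ρ, h1, h2⟩
  · have hp : (e.st k i).pos = (e.st k' i).pos := by simp [LocalState.pos, hpc, hr]
    rcases hg.timer hp with h' | h'
    · exact .inl (h'.trans hd)
    · exact .inl h'
  · refine .inr ⟨ρ, ?_, h2.trans (LocalState.numSenders_mono hg.rcv _)⟩
    simpa [LocalState.miniRound, hpc, hr] using h1

theorem enabled_m07 {i : Fin n} {y : Bool} {s : LocalState n} (hpc : s.pc = .m07)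
    (ht : s.TimerDone t) {V : Finset Bool} (hV : s.ValuesOK t V) :
    Enabled t sr gr y i .m07 s := by
  obtain ⟨W, hW⟩ := LocalState.exists_values hV
  rcases LocalState.eq_singleton_or_univ hW.1.1 with ⟨v, rfl⟩ | rfl
  · exact ⟨0, _, _, .m07Single s v hpc ht hW⟩
  · exact ⟨0, _, _, .m07Both s hpc ht hW⟩

namespace Paced

variable {clk : ℕ → ℝ} {D : ℝ} {k₀ R : ℕ}

theorem not_sent (h : e.Paced clk D k₀ R) (hf : faulty.card ≤ t) {r : ℕ} (hr : R ≤ r)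
    {i : Fin n} (hi : i ∉ faulty) (j : Fin n) :
    (∀ v, (i, j, Msg.est r v) ∉ (e.cfg k₀).sent) ∧
    (∀ w, (i, j, Msg.coord r w) ∉ (e.cfg k₀).sent) ∧
    (∀ A, (i, j, Msg.aux r A) ∉ (e.cfg k₀).sent) := by
  refine ⟨fun v hv => ?_, fun w hw => ?_, fun A hA => ?_⟩
  · obtain ⟨_, p, hp, k', hk', h1, _⟩ := est_justified hf hi ((est_sent_iff hi).1 hv)
    have h2 := (grows (e := e) hp hk').round_le
    have h3 := h.round_lt p hp
    omega
  · obtain ⟨k', hk', h1, _⟩ := exists_coord_step hi hw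
    have h2 := (grows (e := e) hi hk'.le).round_le
    have h3 := h.round_lt i hi
    have h4 := (LocalState.pos_new2 h1).2
    omega
  · obtain ⟨k', hk', h1, _⟩ := exists_aux_step hi hA
    have h2 := (grows (e := e) hi hk'.le).round_le
    have h3 := h.round_lt i hi
    have h4 := (LocalState.pos_m05 h1).2
    omega

theorem deliver_all (h : e.Paced clk D k₀ R) {k : ℕ} (hk : k₀ ≤ k) (A : Finset (Fin n))
    (m : Fin n → Msg)
    (hA : ∀ j ∈ A, j ∉ faulty ∧ ∀ i, (j, i, m j) ∈ (e.cfg k).sent ∧ (j, i, m j) ∉ (e.cfg k₀).sent) :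
    Within clk D 1 k (fun k' => ∀ i ∉ faulty, ∀ j ∈ A, (j, m j) ∈ (e.st k' i).rcv) := by
  refine Within.forall_correct h.nonneg
    (fun i hi k k' hkk hp j hj => (grows hi hkk).rcv (hp j hj)) fun i hi => ?_
  refine Within.forall_fin (P := fun j k' => j ∈ A → (j, m j) ∈ (e.st k' i).rcv) h.nonneg
    (fun j k k' hkk hp hj => (grows hi hkk).rcv (hp hj)) fun j => ?_
  by_cases hj : j ∈ A
  · exact (h.deliver j (hA j hj).1 i hi _ k hk ((hA j hj).2 i).2 ((hA j hj).2 i).1).imp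
      fun _ _ hp _ => hp
  · exact .of_self h.nonneg fun h => absurd h hj

/-- An action that stays executable as long as its purpose is not achieved is executed. -/
theorem act_until (h : e.Paced clk D k₀ R) {i : Fin n} (hi : i ∉ faulty) {a : Action}
    (ha : a ≠ .start) {k : ℕ} (hk : k₀ ≤ k) {P : ℕ → Prop}
    (hP : ∀ k' ≥ k, P k' ∨ Enabled t sr gr (x i) i a (e.st k' i)) : Within clk D 1 k P := by
  rcases hP k le_rfl with h' | h'
  · exact .of_self h.nonneg h'
  · exact (h.act i hi a ha k hk h').imp fun k' hk' hn => (hP k' hk').resolve_right hn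

/-- BV-broadcast: a value that `t + 1` correct processes have broadcast is soon in the set
`bin_values` of every correct process. -/
theorem amplify (h : e.Paced clk D k₀ R) (ht : 3 * t < n) (hf : faulty.card ≤ t) {r : ℕ}
    (hr : R ≤ r) {k : ℕ} (hk : k₀ ≤ k) (hpc : ∀ i ∉ faulty, (e.st k i).pc ≠ .idle) {v : Bool}
    {A : Finset (Fin n)} (hA : t + 1 ≤ A.card)
    (hAv : ∀ j ∈ A, j ∉ faulty ∧ (r, v) ∈ (e.st k j).bcast) :
    Within clk D 4 k (fun k' => ∀ i ∉ faulty, v ∈ (e.st k' i).bin r) := by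
  have hfresh := fun {i} hi j => (h.not_sent hf hr (i := i) hi j).1 v
  have h1 : Within clk D 1 k (fun k' => ∀ i ∉ faulty,
      ∀ j ∈ A, (j, Msg.est r v) ∈ (e.st k' i).rcv) :=
    h.deliver_all hk A (fun _ => .est r v) fun j hj => ⟨(hAv j hj).1, fun i =>
      ⟨(est_sent_iff (hAv j hj).1).2 (hAv j hj).2, hfresh (hAv j hj).1 i⟩⟩
  have h2 := h1.trans (d' := 1) (Q := fun k' => ∀ i ∉ faulty, (r, v) ∈ (e.st k' i).bcast)
    fun k' hk' hq => Within.forall_correct h.nonneg (fun i hi => monotone_bcast hi _)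
      fun i hi => h.act_until hi (a := .echo r v) (by simp) (hk.trans hk') fun k'' hk'' => by
        by_cases hb : (r, v) ∈ (e.st k'' i).bcast
        · exact .inl hb
        · exact .inr ⟨0, _, _, .echo _ r v (pc_ne_idle_mono hi (hk'.trans hk'') (hpc i hi))
            (hA.trans (LocalState.card_le_numSenders A fun j hj =>
              ⟨_, rfl, (grows hi hk'').rcv (hq i hi j hj)⟩)) hb⟩
  have h3 := h2.trans (d' := 1) (Q := fun k' => ∀ i ∉ faulty,
      ∀ j ∈ faultyᶜ, (j, Msg.est r v) ∈ (e.st k' i).rcv)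
    fun k' hk' hq => h.deliver_all (hk.trans hk') faultyᶜ (fun _ => .est r v) fun j hj => by
      have hj := Finset.mem_compl.1 hj
      exact ⟨hj, fun i => ⟨(est_sent_iff hj).2 (hq j hj), hfresh hj i⟩⟩
  refine h3.trans (d' := 1) fun k' hk' hq => Within.forall_correct h.nonneg
    (fun i hi => monotone_bin hi _ _)
    fun i hi => h.act_until hi (a := .bvDeliver r v) (by simp) (hk.trans hk') fun k'' hk'' => ?_
  by_cases hb : v ∈ (e.st k'' i).bin r
  · exact .inl hb
  · refine .inr ⟨0, _, _, .bvDeliver _ r v (pc_ne_idle_mono hi (hk'.trans hk'') (hpc i hi)) ?_ hb⟩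
    have hc := card_correct hf
    exact le_trans (by omega) (LocalState.card_le_numSenders faultyᶜ fun j hj =>
      ⟨_, rfl, (grows hi hk'').rcv (hq i hi j hj)⟩)

/-- BV-uniformity: the values in the sets `bin_values` of the correct processes are soon in the
sets of all of them. -/
theorem bin_uniform (h : e.Paced clk D k₀ R) (ht : 3 * t < n) (hf : faulty.card ≤ t) {r : ℕ}
    (hr : R ≤ r) {k : ℕ} (hk : k₀ ≤ k) (hpc : ∀ i ∉ faulty, (e.st k i).pc ≠ .idle) :
    Within clk D 4 k (fun k' => ∀ v, (∃ p ∉ faulty, v ∈ (e.st k p).bin r) →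
      ∀ i ∉ faulty, v ∈ (e.st k' i).bin r) := by
  refine Within.forall_fin h.nonneg
    (fun v k1 k2 hkk hp hv i hi => (grows hi hkk).bin _ _ (hp hv i hi)) fun v => ?_
  by_cases hv : ∃ p ∉ faulty, v ∈ (e.st k p).bin r
  · obtain ⟨p, hp, hv⟩ := hv
    obtain ⟨A, hA, hA'⟩ := LocalState.exists_correct_senders hf (a := t + 1)
      (le_trans (by omega) (bin_senders hp hv))
    refine (h.amplify ht hf hr hk hpc hA fun j hj => ⟨(hA' j hj).1, ?_⟩).imp fun _ _ hq _ => hq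
    obtain ⟨hj, m, rfl, hm⟩ := hA' j hj
    exact (est_sent_iff hj).1 (sent_of_rcv hp hm)
  · exact .of_self h.nonneg fun hv' => absurd hv' hv

/-- Once all correct processes have entered a round, they soon wait for their first timer in it, or
are beyond, and have values in `bin_values`. -/
theorem to_m05 (h : e.Paced clk D k₀ R) (ht : 3 * t < n) (hf : faulty.card ≤ t) {r : ℕ}
    (hr : R ≤ r) {k : ℕ} (hk : k₀ ≤ k) (hpos : ∀ i ∉ faulty, 5 * r ≤ (e.st k i).pos) :
    Within clk D 6 k (fun k' => ∀ i ∉ faulty,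
      5 * r + 2 ≤ (e.st k' i).pos ∧ (e.st k' i).bin r ≠ []) := by
  classical
  have h1R := h.one_le
  have hpc : ∀ i ∉ faulty, (e.st k i).pc ≠ .idle := fun i hi =>
    LocalState.pc_ne_idle_of_pos (by have := hpos i hi; omega)
  have hc := card_correct hf
  have hv : ∀ i, ∃ v, i ∉ faulty → (r, v) ∈ (e.st k i).bcast := fun i => by
    by_cases hi : i ∈ faulty
    · exact ⟨true, fun h => absurd hi h⟩
    · obtain ⟨v, hv⟩ := exists_bcast hi (by omega) (hpos i hi)
      exact ⟨v, fun _ => hv⟩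
  choose f hf' using hv
  -- one of the two values is the estimate of more than `t` correct processes
  obtain ⟨v, A, hA, hAv⟩ : ∃ v, ∃ A : Finset (Fin n), t + 1 ≤ A.card ∧
      ∀ j ∈ A, j ∉ faulty ∧ (r, v) ∈ (e.st k j).bcast := by
    have hsum := Finset.card_filter_add_card_filter_not (s := faultyᶜ) (fun i => f i = true)
    by_cases hA : t + 1 ≤ ((faultyᶜ).filter fun i => f i = true).card
    · refine ⟨true, _, hA, fun j hj => ?_⟩
      simp only [Finset.mem_filter, Finset.mem_compl] at hj
      exact ⟨hj.1, hj.2 ▸ hf' j hj.1⟩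
    · refine ⟨false, (faultyᶜ).filter fun i => ¬ f i = true, by omega, fun j hj => ?_⟩
      simp only [Finset.mem_filter, Finset.mem_compl, Bool.not_eq_true] at hj
      exact ⟨hj.1, hj.2 ▸ hf' j hj.1⟩
  have h1 := h.amplify ht hf hr hk hpc hA hAv
  have h2 : Within clk D (1 + 3) k (fun k' => ∀ i ∉ faulty,
      ∀ j ∈ faultyᶜ, (j, Msg.est r (f j)) ∈ (e.st k' i).rcv) :=
    (h.deliver_all hk faultyᶜ (fun j => .est r (f j)) fun j hj => by
      have hj := Finset.mem_compl.1 hj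
      exact ⟨hj, fun i => ⟨(est_sent_iff hj).2 (hf' j hj),
        (h.not_sent hf hr hj i).1 _⟩⟩).trans fun k' _ hq => .of_self h.nonneg hq
  have h3 := h1.and h2 (fun k1 k2 hkk hp i hi => (grows hi hkk).bin _ _ (hp i hi))
    (fun k1 k2 hkk hp i hi j hj => (grows hi hkk).rcv (hp i hi j hj))
  have h4 := h3.trans (d' := 1) (Q := fun k' => ∀ i ∉ faulty,
      5 * r + 1 ≤ (e.st k' i).pos ∧ v ∈ (e.st k' i).bin r) fun k' hk' hq =>
    Within.forall_correct h.nonneg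
      (fun i hi k1 k2 hkk hp => ⟨monotone_pos hi _ hkk hp.1, monotone_bin hi _ _ hkk hp.2⟩)
      fun i hi => h.act_until hi (a := .new1) (by simp) (hk.trans hk') fun k'' hk'' => by
        have hbin := (grows (e := e) hi hk'').bin _ _ (hq.1 i hi)
        by_cases hb : 5 * r + 1 ≤ (e.st k'' i).pos
        · exact .inl ⟨hb, hbin⟩
        · have hb' := (hpos i hi).trans (pos_mono hi (hk'.trans hk''))
          obtain ⟨hp, hrd⟩ := LocalState.pos_new1 (s := e.st k'' i) (r := r) (by omega) (by omega)
          refine .inr ⟨0, _, _, .new1 _ hp ?_⟩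
          cases sr with
          | quorum =>
            exact hc.trans (LocalState.card_le_numSenders faultyᶜ fun j hj =>
              ⟨_, ⟨f j, by rw [hrd]⟩, (grows hi hk'').rcv (hq.2 i hi j hj)⟩)
          | delivered =>
            change (e.st k'' i).bin (e.st k'' i).round ≠ []
            rw [hrd]
            exact List.ne_nil_of_mem hbin
  refine h4.trans (d' := 1) fun k' hk' hq => Within.forall_correct h.nonneg
      (fun i hi k1 k2 hkk hp => ⟨monotone_pos hi _ hkk hp.1, bin_ne_nil_mono hi hkk hp.2⟩)
      fun i hi => h.act_until hi (a := .new2) (by simp) (hk.trans hk') fun k'' hk'' => ?_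
  have hbin := List.ne_nil_of_mem ((grows hi hk'').bin _ _ (hq i hi).2)
  by_cases hb : 5 * r + 2 ≤ (e.st k'' i).pos
  · exact .inl ⟨hb, hbin⟩
  · have hb' := (hq i hi).1.trans (pos_mono hi hk'')
    obtain ⟨hp, rfl⟩ := LocalState.pos_new2 (s := e.st k'' i) (r := r) (by omega)
    by_cases hcd : IsCoord i (e.st k'' i).round
    · exact .inr ⟨0, _, _, .new2Coord _ _ hp hcd (List.head?_eq_some_head hbin)⟩
    · exact .inr ⟨0, _, _, .new2Other _ hp hcd⟩

/-- The value of a correct coordinator reaches all correct processes. -/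
theorem coord_value (h : e.Paced clk D k₀ R) (ht : 3 * t < n) (hf : faulty.card ≤ t) {r : ℕ}
    (hr : R ≤ r) {k : ℕ} (hk : k₀ ≤ k) (hpos : ∀ i ∉ faulty, 5 * r + 2 ≤ (e.st k i).pos)
    {c : Fin n} (hc : c ∉ faulty) (hcr : IsCoord c r) :
    ∃ w, (∀ j, (c, j, Msg.coord r w) ∈ (e.cfg k).sent) ∧ Within clk D 4 k (fun k' => ∀ i ∉ faulty,
      (c, Msg.coord r w) ∈ (e.st k' i).rcv ∧ w ∈ (e.st k' i).bin r) := by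
  have h1R := h.one_le
  obtain ⟨w, hw, hs⟩ := exists_coord hc (by omega) (hpos c hc) hcr
  have hpc : ∀ i ∉ faulty, (e.st k i).pc ≠ .idle := fun i hi =>
    LocalState.pc_ne_idle_of_pos (by have := hpos i hi; omega)
  have h1 : Within clk D (1 + 3) k (fun k' => ∀ i ∉ faulty,
      ∀ j ∈ ({c} : Finset (Fin n)), (j, Msg.coord r w) ∈ (e.st k' i).rcv) :=
    (h.deliver_all hk {c} (fun _ => .coord r w) fun j hj => by
      obtain rfl := Finset.mem_singleton.1 hj
      exact ⟨hc, fun i => ⟨hs i, (h.not_sent hf hr hc i).2.1 w⟩⟩).trans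
        fun k' _ hq => .of_self h.nonneg hq
  have h2 := h.bin_uniform ht hf hr hk hpc
  refine ⟨w, hs, (h1.and h2 (fun k1 k2 hkk hp i hi j hj => (grows hi hkk).rcv (hp i hi j hj))
    (fun k1 k2 hkk hp v hv i hi => (grows hi hkk).bin _ _ (hp v hv i hi))).imp
      fun k' hk' hq i hi => ⟨hq.1 i hi c (Finset.mem_singleton_self c), hq.2 w ⟨c, hc, hw⟩ i hi⟩⟩

theorem to_new4 (h : e.Paced clk D k₀ R) {r : ℕ} {k : ℕ} (hk : k₀ ≤ k)
    (hpos : ∀ i ∉ faulty, 5 * r + 2 ≤ (e.st k i).pos ∧ (e.st k i).bin r ≠ [])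
    (htimer : ∀ i ∉ faulty, ∀ k' ≥ k, (e.st k' i).pos = 5 * r + 2 →
      Within clk D 1 k' (fun k'' => 5 * r + 3 ≤ (e.st k'' i).pos ∨ (e.st k'' i).TimerDone t)) :
    Within clk D 2 k (fun k' => ∀ i ∉ faulty, 5 * r + 3 ≤ (e.st k' i).pos) := by
  refine Within.forall_correct h.nonneg (fun i hi => monotone_pos hi _) fun i hi => ?_
  have h1 : Within clk D 1 k
      (fun k'' => 5 * r + 3 ≤ (e.st k'' i).pos ∨ (e.st k'' i).TimerDone t) := by
    by_cases hb : 5 * r + 3 ≤ (e.st k i).pos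
    · exact .of_self h.nonneg (.inl hb)
    · exact htimer i hi k le_rfl (by have := (hpos i hi).1; omega)
  refine h1.trans (d' := 1) fun k' hk' hq => h.act_until hi (a := .m05) (by simp) (hk.trans hk')
    fun k'' hk'' => ?_
  by_cases hb : 5 * r + 3 ≤ (e.st k'' i).pos
  · exact .inl hb
  · right
    have hm := pos_mono (e := e) hi hk''
    have hm' := pos_mono (e := e) hi hk'
    have := (hpos i hi).1
    obtain ⟨hp', hr'⟩ := LocalState.pos_m05 (s := e.st k' i) (r := r) (by omega)
    obtain ⟨hp, hr⟩ := LocalState.pos_m05 (s := e.st k'' i) (r := r) (by omega)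
    obtain ⟨A, hA⟩ := (e.st k'' i).exists_newAux
    refine ⟨0, _, _, .m05 _ A hp ?_ ?_ hA⟩
    · rw [hr]; exact bin_ne_nil_mono hi (hk'.trans hk'') (hpos i hi).2
    · exact timerDone_mono hi hk'' (by rw [hp, hp']) (by rw [hr, hr'])
        (hq.resolve_left (by omega))

/-- The `AUX` messages of the correct processes are received by all of them. -/
theorem aux_received (h : e.Paced clk D k₀ R) (hf : faulty.card ≤ t) {r : ℕ}
    (hr : R ≤ r) {k : ℕ} (hk : k₀ ≤ k) (hpos : ∀ i ∉ faulty, 5 * r + 3 ≤ (e.st k i).pos) :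
    ∃ b : Fin n → Finset Bool, (∀ j ∉ faulty, ∀ i, (j, i, Msg.aux r (b j)) ∈ (e.cfg k).sent) ∧
      Within clk D 1 k (fun k' => ∀ i ∉ faulty,
        ∀ j ∈ faultyᶜ, (j, Msg.aux r (b j)) ∈ (e.st k' i).rcv) := by
  have h1R := h.one_le
  have hv : ∀ j, ∃ A, j ∉ faulty → ∀ i, (j, i, Msg.aux r A) ∈ (e.cfg k).sent := fun j => by
    by_cases hj : j ∈ faulty
    · exact ⟨∅, fun h => absurd hj h⟩
    · obtain ⟨v, hv⟩ := exists_aux hj (by omega) (hpos j hj)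
      exact ⟨v, fun _ => hv⟩
  choose b hb using hv
  exact ⟨b, hb, h.deliver_all hk faultyᶜ (fun j => .aux r (b j)) fun j hj => by
    have hj := Finset.mem_compl.1 hj
    exact ⟨hj, fun i => ⟨hb j hj i, (h.not_sent hf hr hj i).2.2 _⟩⟩⟩

theorem to_m07 (h : e.Paced clk D k₀ R) (hf : faulty.card ≤ t) {r : ℕ}
    (hr : R ≤ r) {k : ℕ} (hk : k₀ ≤ k) (hpos : ∀ i ∉ faulty, 5 * r + 3 ≤ (e.st k i).pos) :
    Within clk D 2 k (fun k' => ∀ i ∉ faulty, 5 * r + 4 ≤ (e.st k' i).pos) := by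
  obtain ⟨b, _, h1⟩ := h.aux_received hf hr hk hpos
  refine h1.trans (d' := 1) fun k' hk' hq => Within.forall_correct h.nonneg
    (fun i hi => monotone_pos hi _)
    fun i hi => h.act_until hi (a := .new4) (by simp) (hk.trans hk') fun k'' hk'' => ?_
  by_cases hb : 5 * r + 4 ≤ (e.st k'' i).pos
  · exact .inl hb
  · have hb' := (hpos i hi).trans (pos_mono hi (hk'.trans hk''))
    obtain ⟨hp, hrd⟩ := LocalState.pos_new4 (s := e.st k'' i) (r := r) (by omega)
    refine .inr ⟨0, _, _, .new4 _ _ hp ?_ rfl⟩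
    exact (card_correct hf).trans (LocalState.card_le_numSenders faultyᶜ fun j hj =>
      ⟨_, ⟨b j, by rw [hrd]⟩, (grows hi hk'').rcv (hq i hi j hj)⟩)

theorem to_next_round (h : e.Paced clk D k₀ R) (ht : 3 * t < n) (hf : faulty.card ≤ t) {r : ℕ}
    (hr : R ≤ r) {k : ℕ} (hk : k₀ ≤ k) (hpos : ∀ i ∉ faulty, 5 * r + 4 ≤ (e.st k i).pos)
    (htimer : ∀ i ∉ faulty, ∀ k' ≥ k, (e.st k' i).pos = 5 * r + 4 →
      Within clk D 1 k' (fun k'' => 5 * (r + 1) ≤ (e.st k'' i).pos ∨ (e.st k'' i).TimerDone t)) :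
    Within clk D 6 k (fun k' => ∀ i ∉ faulty, 5 * (r + 1) ≤ (e.st k' i).pos) := by
  have hpc : ∀ i ∉ faulty, (e.st k i).pc ≠ .idle := fun i hi =>
    LocalState.pc_ne_idle_of_pos (by have := hpos i hi; omega)
  obtain ⟨b, hbs, h1⟩ := h.aux_received hf hr hk fun i hi => by have := hpos i hi; omega
  have h1' : Within clk D (1 + 3) k (fun k' => ∀ i ∉ faulty,
      ∀ j ∈ faultyᶜ, (j, Msg.aux r (b j)) ∈ (e.st k' i).rcv) :=
    h1.trans fun k' _ hq => .of_self h.nonneg hq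
  obtain ⟨Q, hQ, hQc⟩ := Finset.exists_subset_card_eq (card_correct (n := n) hf)
  have hQf : ∀ j ∈ Q, j ∉ faulty := fun j hj => Finset.mem_compl.1 (hQ hj)
  have h2 := h1'.and (h.bin_uniform ht hf hr hk hpc)
    (fun k1 k2 hkk hp i hi j hj => (grows hi hkk).rcv (hp i hi j hj))
    (fun k1 k2 hkk hp v hv i hi => (grows hi hkk).bin _ _ (hp v hv i hi))
  refine h2.trans (d' := 2) fun k1 hk1 hq =>
    Within.forall_correct h.nonneg (fun i hi => monotone_pos hi _) fun i hi => ?_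
  have h3 : Within clk D 1 k1
      (fun k'' => 5 * (r + 1) ≤ (e.st k'' i).pos ∨ (e.st k'' i).TimerDone t) := by
    by_cases hb : 5 * (r + 1) ≤ (e.st k1 i).pos
    · exact .of_self h.nonneg (.inl hb)
    · exact htimer i hi k1 hk1 (by have := hpos i hi; have := pos_mono (e := e) hi hk1; omega)
  refine h3.trans (d' := 1) fun k' hk' hq' => h.act_until hi (a := .m07) (by simp)
    (hk.trans (hk1.trans hk')) fun k'' hk'' => ?_
  by_cases hb : 5 * (r + 1) ≤ (e.st k'' i).pos
  · exact .inl hb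
  · right
    have hm := pos_mono (e := e) hi hk''
    have hm' := pos_mono (e := e) hi (hk1.trans hk')
    have := hpos i hi
    obtain ⟨hp', hr'⟩ := LocalState.pos_m07 (s := e.st k' i) (r := r) (by omega)
    obtain ⟨hp, hr⟩ := LocalState.pos_m07 (s := e.st k'' i) (r := r) (by omega)
    have htd := timerDone_mono hi hk'' (by rw [hp, hp']) (by rw [hr, hr'])
        (hq'.resolve_left (by omega))
    refine enabled_m07 hp htd (V := Q.biUnion b) ⟨?_, ?_, Q, b, hQc, ?_, rfl⟩
    · obtain ⟨q, hq⟩ : Q.Nonempty := Finset.card_pos.1 (by omega)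
      obtain ⟨v, hv⟩ := aux_nonempty (hQf q hq) (hbs q (hQf q hq) i)
      exact ⟨v, Finset.mem_biUnion.2 ⟨q, hq, hv⟩⟩
    · intro v hv
      obtain ⟨q, hqQ, hv⟩ := Finset.mem_biUnion.1 hv
      rw [List.mem_toFinset, hr]
      refine (grows hi (hk'.trans hk'')).bin _ _ (hq.2 v ⟨q, hQf q hqQ, ?_⟩ i hi)
      exact aux_subset_bin (hQf q hqQ) (hbs q (hQf q hqQ) i) v hv
    · intro j hj
      rw [hr]
      exact (grows hi (hk'.trans hk'')).rcv (hq.1 i hi j (hQ hj))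

/-- A round takes a bounded time if no process has to wait for its timers. -/
theorem round_progress (h : e.Paced clk D k₀ R) (ht : 3 * t < n) (hf : faulty.card ≤ t) {r : ℕ}
    (hr : R ≤ r) {k : ℕ} (hk : k₀ ≤ k) (hpos : ∀ i ∉ faulty, 5 * r ≤ (e.st k i).pos)
    (htimer : ∀ i ∉ faulty, ∀ k' ≥ k, ∀ q, q = 5 * r + 2 ∨ q = 5 * r + 4 → (e.st k' i).pos = q →
      Within clk D 1 k' (fun k'' => q + 1 ≤ (e.st k'' i).pos ∨ (e.st k'' i).TimerDone t)) :
    Within clk D 16 k (fun k' => ∀ i ∉ faulty, 5 * (r + 1) ≤ (e.st k' i).pos) := by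
  refine (((h.to_m05 ht hf hr hk hpos).trans (d' := 2) fun k1 hk1 h1 =>
    h.to_new4 (hk.trans hk1) h1 fun i hi k' hk' =>
      htimer i hi k' (hk1.trans hk') _ (.inl rfl)).trans (d' := 2) fun k1 hk1 h1 =>
    h.to_m07 hf hr (hk.trans hk1) h1).trans (d' := 6) fun k1 hk1 h1 =>
    h.to_next_round ht hf hr (hk.trans hk1) h1 fun i hi k' hk' =>
      htimer i hi k' (hk1.trans hk') _ (.inr rfl)

end Paced

/-! ### Timers -/

/-- From the instant `τ` on, a timer set to `T` does not expire before `T / c` time units. -/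
def SlowTimers (e : Execution n t sr gr faulty x) (τ c : ℝ) : Prop :=
  ∀ i ∉ faulty, ∀ k since T, τ ≤ since → (e.st k i).timer = .running since T →
    (e.st (k + 1) i).timer = .expired → since + T / c ≤ e.time (k + 1)

theorem timeout_ge {i : Fin n} (hi : i ∉ faulty) (k : ℕ) :
    (e.st k i).round ≤ (e.st k i).timeout + 1 ∧
      ((e.st k i).pc ≠ .new1 → (e.st k i).round ≤ (e.st k i).timeout) := by
  induction k with
  | zero => simp [st_zero, LocalState.initial]
  | succ k ih =>
    rcases e.step_cases hi k with ⟨_, _, hs, _⟩ | ⟨a, out, hs, _⟩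
    · rw [hs]; exact ih
    · exact hs.timeout_ge ih

/-- In a phase with a timer, the timer was set when the process arrived in the phase, to at least
the number of the round, and if it has expired, then only after the due time. -/
theorem timer_inv {τ c : ℝ} (hc : 0 < c) (hslow : e.SlowTimers τ c) {i : Fin n} (hi : i ∉ faulty)
    {k : ℕ} (hk : (e.st k i).Timed) :
    (∃ since T, (e.st k i).timer = .running since T ∧ (e.st k i).round ≤ T ∧
        ∃ k' ≤ k, since = e.time k' ∧ (e.st k' i).pos = (e.st k i).phaseStart) ∨
      ((e.st k i).timer = .expired ∧ ∃ k' ≤ k, (e.st k' i).pos = (e.st k i).phaseStart ∧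
        (τ ≤ e.time k' → e.time k' + (e.st k i).round / c ≤ e.time k)) := by
  induction k with
  | zero => simp [st_zero, LocalState.initial, LocalState.Timed] at hk
  | succ k ih =>
    have htime := e.time_mono (Nat.le_succ k)
    rcases e.step_cases hi k with ⟨rcv, timer, hs, _, _, ht, _⟩ | ⟨a, out, hs, _⟩
    · have hpc : (e.st (k + 1) i).pc = (e.st k i).pc := by rw [hs]
      have hr : (e.st (k + 1) i).round = (e.st k i).round := by rw [hs]
      have hph : (e.st (k + 1) i).phaseStart = (e.st k i).phaseStart := by
        simp [LocalState.phaseStart, hpc, hr]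
      have ht' : (e.st (k + 1) i).timer = timer := by rw [hs]
      have hk' : (e.st k i).Timed := by simpa [LocalState.Timed, hpc] using hk
      rw [hr, hph, ht']
      rcases ht with rfl | ⟨since, T, h1, rfl⟩
      · rcases ih hk' with ⟨since, T, h1, h2, k', h3, h4⟩ | ⟨h1, k', h2, h3, h4⟩
        · exact .inl ⟨since, T, h1, h2, k', by omega, h4⟩
        · exact .inr ⟨h1, k', by omega, h3, fun h => (h4 h).trans htime⟩
      · rcases ih hk' with ⟨since', T', h1', h2, k', h3, h4, h5⟩ | ⟨h1', _⟩
        · rw [h1] at h1'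
          cases h1'
          refine .inr ⟨rfl, k', by omega, h5, fun h => ?_⟩
          have h6 := hslow i hi k since T (h4 ▸ h) h1 ht'
          have h7 : ((e.st k i).round : ℝ) / c ≤ T / c := by
            gcongr
          rw [← h4]
          linarith
        · rw [h1] at h1'
          cases h1'
    · rcases hs.timer_cases (e.timeout_ge hi k) with ⟨h1, h2, h3, h4⟩ | ⟨_, h⟩ | ⟨T, h1, h2, h3, _⟩
      · rw [h1, h2, h3]
        rcases ih (h4 hk) with ⟨since, T, h1, h2, k', h3, h4⟩ | ⟨h1, k', h2, h3, h4⟩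
        · exact .inl ⟨since, T, h1, h2, k', by omega, h4⟩
        · exact .inr ⟨h1, k', by omega, h3, fun h => (h4 h).trans htime⟩
      · exact absurd hk h
      · exact .inl ⟨_, T, h1, h2, k + 1, le_rfl, rfl, h3⟩

/-! ### All correct processes go through all rounds -/

theorem paced_untimed : e.Paced (fun _ => 0) 0 0 1 where
  nonneg := le_rfl
  one_le := le_rfl
  round_lt i _ := by simp [st_zero, LocalState.initial]
  deliver i hi j hj m k _ _ hk := by
    obtain ⟨k', hk'⟩ := e.reliable i hi j hj m k hk
    exact ⟨max k k', le_max_left _ _, by simp, (grows hj (le_max_right k k')).rcv hk'⟩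
  act i hi a _ k _ hk := by
    obtain ⟨k', hk', h⟩ := e.progress i hi a k hk
    exact ⟨k', hk', by simp, h⟩

theorem exists_started {i : Fin n} (hi : i ∉ faulty) : ∃ k, 5 ≤ (e.st k i).pos := by
  obtain ⟨k, _, hk⟩ := e.progress i hi .start 0
    ⟨0, _, _, .start _ (by simp [e.cfg_zero, Config.initial, LocalState.initial])⟩
  have hpc : (e.st k i).pc ≠ .idle := fun h => hk ⟨0, _, _, .start _ h⟩
  exact ⟨k, e.le_pos_of_le_round hi (e.one_le_round hi k hpc)⟩

theorem exists_timerDone {τ c : ℝ} (hc : 0 < c) (hslow : e.SlowTimers τ c) {i : Fin n}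
    (hi : i ∉ faulty) {k : ℕ} (hk : (e.st k i).Timed) :
    ∃ k' ≥ k, (e.st k i).pos + 1 ≤ (e.st k' i).pos ∨ (e.st k' i).TimerDone t := by
  rcases timer_inv hc hslow hi hk with ⟨since, T, h, _⟩ | ⟨h, _⟩
  · obtain ⟨k', hk', h'⟩ := e.timers i hi k since T h
    have hg := e.grows hi hk'
    refine ⟨k', hk', ?_⟩
    rcases hg.pos_le.eq_or_lt with hp | hp
    · rcases hg.timer hp with h1 | h1
      · exact absurd (h1.trans h) h'
      · exact .inr (.inl h1)
    · exact .inl hp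
  · exact ⟨k, le_rfl, .inr (.inl h)⟩

theorem exists_all_pos (ht : 3 * t < n) (hf : faulty.card ≤ t) {τ c : ℝ} (hc : 0 < c)
    (hslow : e.SlowTimers τ c) (p : ℕ) : ∃ k, ∀ i ∉ faulty, p ≤ (e.st k i).pos := by
  suffices h : ∀ r ≥ 1, ∃ k, ∀ i ∉ faulty, 5 * r ≤ (e.st k i).pos by
    obtain ⟨k, hk⟩ := h (p + 1) (by omega)
    exact ⟨k, fun i hi => le_trans (by omega) (hk i hi)⟩
  intro r hr
  induction r, hr using Nat.le_induction with
  | base =>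
    obtain ⟨k, _, _, hk⟩ := Within.forall_correct (clk := fun _ => 0) (k := 0) (d := 0)
      (P := fun i k => 5 ≤ (e.st k i).pos) e.paced_untimed.nonneg
      (fun i hi => monotone_pos hi _) fun i hi => by
        obtain ⟨k, hk⟩ := e.exists_started hi
        exact ⟨k, Nat.zero_le _, by simp, hk⟩
    exact ⟨k, hk⟩
  | succ r hr ih =>
    obtain ⟨k, hk⟩ := ih
    obtain ⟨k', _, _, hk'⟩ := e.paced_untimed.round_progress ht hf hr (Nat.zero_le k) hk
      fun i hi k' _ q hq hp => by
        have hT : (e.st k' i).Timed := by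
          rcases hq with rfl | rfl
          · exact .inr (.inl (LocalState.pos_m05 hp).1)
          · exact .inr (.inr (LocalState.pos_m07 hp).1)
        obtain ⟨k'', hk'', h⟩ := exists_timerDone hc hslow hi hT
        exact ⟨k'', hk'', by simp, hp ▸ h⟩
    exact ⟨k', hk'⟩

/-! ### The first and the last process at a position -/

/-- The first configuration in which some correct process has reached position `p`. -/
noncomputable def firstAt (e : Execution n t sr gr faulty x) (p : ℕ) : ℕ :=
  sInf {k | ∃ i ∉ faulty, p ≤ (e.st k i).pos}

/-- The first configuration in which all correct processes have reached position `p`. -/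
noncomputable def allAt (e : Execution n t sr gr faulty x) (p : ℕ) : ℕ :=
  sInf {k | ∀ i ∉ faulty, p ≤ (e.st k i).pos}

theorem firstAt_le {p k : ℕ} {i : Fin n} (hi : i ∉ faulty) (h : p ≤ (e.st k i).pos) :
    e.firstAt p ≤ k :=
  Nat.sInf_le ⟨i, hi, h⟩

theorem exists_correct (ht : 3 * t < n) (hf : faulty.card ≤ t) : ∃ i, i ∉ faulty := by
  have := card_correct (n := n) hf
  obtain ⟨i, hi⟩ : (faultyᶜ).Nonempty := Finset.card_pos.1 (by omega)
  exact ⟨i, Finset.mem_compl.1 hi⟩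

theorem allAt_spec {p : ℕ} (h : ∃ k, ∀ i ∉ faulty, p ≤ (e.st k i).pos) :
    ∀ i ∉ faulty, p ≤ (e.st (e.allAt p) i).pos :=
  Nat.sInf_mem (s := {k | ∀ i ∉ faulty, p ≤ (e.st k i).pos}) h

theorem firstAt_spec (hne : ∃ i, i ∉ faulty) {p : ℕ}
    (h : ∃ k, ∀ i ∉ faulty, p ≤ (e.st k i).pos) :
    ∃ i ∉ faulty, p ≤ (e.st (e.firstAt p) i).pos := by
  obtain ⟨i, hi⟩ := hne
  obtain ⟨k, hk⟩ := h
  exact Nat.sInf_mem (s := {k | ∃ i ∉ faulty, p ≤ (e.st k i).pos}) ⟨k, i, hi, hk i hi⟩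

theorem firstAt_mono (hne : ∃ i, i ∉ faulty) {p q : ℕ} (hpq : p ≤ q)
    (h : ∃ k, ∀ i ∉ faulty, q ≤ (e.st k i).pos) : e.firstAt p ≤ e.firstAt q := by
  obtain ⟨i, hi, hq⟩ := firstAt_spec hne h
  exact firstAt_le hi (hpq.trans hq)

/-- A correct process sends messages of a mini-round only when some correct process has reached this
mini-round: an echo of a `B_VAL` message can run ahead of its sender, but not of all correct
processes. -/
theorem miniRound_reached (hf : faulty.card ≤ t) {k : ℕ} {i j : Fin n} (hi : i ∉ faulty) {m : Msg}
    (h : (i, j, m) ∈ (e.cfg k).sent) : ∃ p ∉ faulty, m.miniRound ≤ (e.st k p).miniRound := by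
  cases m with
  | est r v =>
    obtain ⟨_, p, hp, k', hk', h1, _⟩ := est_justified hf hi ((est_sent_iff hi).1 h)
    refine ⟨p, hp, LocalState.miniRound_of_pos_even ?_⟩
    exact (e.le_pos_of_le_round hp h1.ge).trans (pos_mono hp hk')
  | coord r w =>
    obtain ⟨k', hk', h1, _⟩ := exists_coord_step hi h
    have := pos_mono (e := e) hi hk'.le
    exact ⟨i, hi, LocalState.miniRound_of_pos_even (by omega)⟩
  | aux r A =>
    obtain ⟨k', hk', _, h1, _⟩ := exists_aux_step hi h
    have := pos_mono (e := e) hi (show k' + 1 ≤ k from hk')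
    exact ⟨i, hi, LocalState.miniRound_of_pos_odd (by omega)⟩

/-- The catch-up condition of a process shows that some correct process has left its mini-round. -/
theorem exists_ahead (hf : faulty.card ≤ t) {k : ℕ} {i : Fin n} (hi : i ∉ faulty)
    (h : (e.st k i).CatchUp t) : ∃ p ∉ faulty, (e.st k i).miniRound < (e.st k p).miniRound := by
  obtain ⟨ρ, hρ, hq⟩ := h
  obtain ⟨j, hj, m, rfl, hm⟩ := LocalState.exists_correct_sender hf hq
  obtain ⟨p, hp, h'⟩ := miniRound_reached hf hj (sent_of_rcv hi hm)
  exact ⟨p, hp, hρ.trans_le h'⟩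

/-- The first correct process to leave the mini-round `2r` cannot catch up with anybody, so it has
waited until its timer expired. -/
theorem first_timer (hf : faulty.card ≤ t) (hne : ∃ i, i ∉ faulty) {τ c : ℝ} (hc : 0 < c)
    (hslow : e.SlowTimers τ c) (hall : ∀ p, ∃ k, ∀ i ∉ faulty, p ≤ (e.st k i).pos) {r : ℕ}
    (hr : 1 ≤ r) (hτ : τ ≤ e.time (e.firstAt (5 * r + 1))) :
    e.time (e.firstAt (5 * r + 1)) + r / c ≤ e.time (e.firstAt (5 * r + 3)) := by
  obtain ⟨i, hi, hp⟩ := firstAt_spec hne (hall (5 * r + 3))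
  obtain ⟨k, hk, h1, h2, a, out, hs, _⟩ := exists_cross hi (by omega) hp
  obtain ⟨h3, h4, _⟩ := hs.cross_m05 (e.idle_round hi k) hr h1 h2
  obtain ⟨hpc, hrd⟩ := LocalState.pos_m05 h3
  rcases h4 with h4 | h4
  · rcases timer_inv hc hslow hi (k := k) (.inr (.inl hpc)) with ⟨_, _, h, _⟩ | ⟨_, k', hk', h5, h6⟩
    · rw [h] at h4; cases h4
    · rw [LocalState.phaseStart, hpc, hrd] at h5
      have h7 := e.time_mono (firstAt_le hi (p := 5 * r + 1) h5.ge)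
      have h8 := h6 (hτ.trans h7)
      have h9 := e.time_mono hk.le
      rw [hrd] at h8
      linarith
  · obtain ⟨p, hp, h5⟩ := exists_ahead hf hi h4
    rw [LocalState.miniRound_m05 hpc, hrd] at h5
    have := firstAt_le hp (LocalState.pos_of_miniRound_odd (e.idle_round hp k) h5)
    omega

/-- The analogue of `first_timer` for the mini-round `2r + 1`. -/
theorem second_timer (hf : faulty.card ≤ t) (hne : ∃ i, i ∉ faulty) {τ c : ℝ} (hc : 0 < c)
    (hslow : e.SlowTimers τ c) (hall : ∀ p, ∃ k, ∀ i ∉ faulty, p ≤ (e.st k i).pos) {r : ℕ}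
    (hr : 1 ≤ r) (hτ : τ ≤ e.time (e.firstAt (5 * r + 4))) :
    e.time (e.firstAt (5 * r + 4)) + r / c ≤ e.time (e.firstAt (5 * (r + 1))) := by
  obtain ⟨i, hi, hp⟩ := firstAt_spec hne (hall (5 * (r + 1)))
  obtain ⟨k, hk, h1, h2, a, out, hs, _⟩ := exists_cross hi (by omega) hp
  obtain ⟨h3, _, h4, _⟩ := hs.cross_m07 (e.idle_round hi k) hr h1 h2
  obtain ⟨hpc, hrd⟩ := LocalState.pos_m07 h3
  rcases h4 with h4 | h4
  · rcases timer_inv hc hslow hi (k := k) (.inr (.inr hpc)) with ⟨_, _, h, _⟩ | ⟨_, k', hk', h5, h6⟩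
    · rw [h] at h4; cases h4
    · rw [LocalState.phaseStart, hpc, hrd] at h5
      have h7 := e.time_mono (firstAt_le hi (p := 5 * r + 4) h5.ge)
      have h8 := h6 (hτ.trans h7)
      have h9 := e.time_mono hk.le
      rw [hrd] at h8
      linarith
  · obtain ⟨p, hp, h5⟩ := exists_ahead hf hi h4
    rw [LocalState.miniRound_m07 hpc, hrd] at h5
    have := firstAt_le hp (LocalState.pos_of_miniRound_even (e.idle_round hp k) h5)
    omega

/-! ### Catching up -/

/-- When some process has passed New1 in round `r`, then `t + 1` correct processes have sent
`B_VAL` messages of this round. -/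
theorem est_senders (ht : 3 * t < n) (hf : faulty.card ≤ t) {k r : ℕ} (hr : 1 ≤ r) {i : Fin n}
    (hi : i ∉ faulty) (h : 5 * r + 1 ≤ (e.st k i).pos) :
    ∃ A : Finset (Fin n), t + 1 ≤ A.card ∧
      ∀ j ∈ A, j ∉ faulty ∧ ∃ v, ∀ i, (j, i, Msg.est r v) ∈ (e.cfg k).sent := by
  obtain ⟨k', hk', h1, h2, a, out, hs, _⟩ := exists_cross hi (by omega) h
  obtain ⟨h3, _, h4⟩ := hs.cross_new1 (e.idle_round hi k') hr h1 h2
  have hrd := (LocalState.pos_new1 hr h3).2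
  have key : ∃ A : Finset (Fin n), t + 1 ≤ A.card ∧
      ∀ j ∈ A, j ∉ faulty ∧ ∃ m, (∃ v, m = .est r v) ∧ (j, m) ∈ (e.st k' i).rcv := by
    cases sr with
    | quorum =>
      change n - t ≤ _ at h4
      rw [hrd] at h4
      exact LocalState.exists_correct_senders hf (le_trans (by omega) h4)
    | delivered =>
      change (e.st k' i).bin (e.st k' i).round ≠ [] at h4
      rw [hrd] at h4
      obtain ⟨v, hv⟩ := List.exists_mem_of_ne_nil _ h4
      obtain ⟨A, hA, hA'⟩ := LocalState.exists_correct_senders hf (a := t + 1)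
        (le_trans (by omega) (bin_senders hi hv))
      refine ⟨A, hA, fun j hj => ⟨(hA' j hj).1, ?_⟩⟩
      obtain ⟨m, hm, hm'⟩ := (hA' j hj).2
      exact ⟨m, ⟨v, hm⟩, hm'⟩
  obtain ⟨A, hA, hA'⟩ := key
  refine ⟨A, hA, fun j hj => ?_⟩
  obtain ⟨hjf, m, ⟨v, rfl⟩, hm⟩ := hA' j hj
  refine ⟨hjf, v, fun p => e.sent_mono hk'.le ((est_sent_iff hjf).2 ?_)⟩
  exact (est_sent_iff hjf).1 (sent_of_rcv hi hm)

theorem aux_sent_all {i : Fin n} (hi : i ∉ faulty) {k r : ℕ} (hr : 1 ≤ r) {j : Fin n}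
    {A : Finset Bool} (h : (i, j, Msg.aux r A) ∈ (e.cfg k).sent) (p : Fin n) :
    (i, p, Msg.aux r A) ∈ (e.cfg k).sent := by
  obtain ⟨k', hk', _, h1, _⟩ := exists_aux_step hi h
  obtain ⟨B, hB⟩ := exists_aux hi hr (h1.ge.trans (e.pos_mono hi (show k' + 1 ≤ k from hk')))
  rw [aux_unique hi h (hB j)]
  exact hB p

/-- When some process has passed New4 in round `r`, then `t + 1` correct processes have sent
`AUX` messages of this round. -/
theorem aux_senders (ht : 3 * t < n) (hf : faulty.card ≤ t) {k r : ℕ} (hr : 1 ≤ r) {i : Fin n}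
    (hi : i ∉ faulty) (h : 5 * r + 4 ≤ (e.st k i).pos) :
    ∃ A : Finset (Fin n), t + 1 ≤ A.card ∧
      ∀ j ∈ A, j ∉ faulty ∧ ∃ S, ∀ i, (j, i, Msg.aux r S) ∈ (e.cfg k).sent := by
  obtain ⟨k', hk', h1, h2, a, out, hs, _⟩ := exists_cross hi (by omega) h
  obtain ⟨h3, h4⟩ := hs.cross_new4 (e.idle_round hi k') hr h1 h2
  obtain ⟨A, hA, hA'⟩ := LocalState.exists_correct_senders hf (a := t + 1)
    (le_trans (by omega) h4)
  refine ⟨A, hA, fun j hj => ?_⟩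
  obtain ⟨hjf, m, ⟨S, rfl⟩, hm⟩ := hA' j hj
  exact ⟨hjf, S, aux_sent_all hjf hr (e.sent_mono hk'.le (sent_of_rcv hi hm))⟩

namespace Paced

variable {clk : ℕ → ℝ} {D : ℝ} {k₀ R : ℕ}

/-- Messages of the mini-round `ρ` sent by `t + 1` correct processes soon relieve all correct
processes in earlier mini-rounds of waiting for their timers. -/
theorem catchUp (h : e.Paced clk D k₀ R) {k : ℕ} (hk : k₀ ≤ k) {A : Finset (Fin n)}
    (hA : t + 1 ≤ A.card) {ρ : ℕ} (hAm : ∀ j ∈ A, j ∉ faulty ∧ ∃ m : Msg, m.miniRound = ρ ∧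
      ∀ i, (j, i, m) ∈ (e.cfg k).sent ∧ (j, i, m) ∉ (e.cfg k₀).sent) :
    Within clk D 1 k (fun k' => ∀ i ∉ faulty, ∀ k'' ≥ k', (e.st k'' i).miniRound < ρ →
      (e.st k'' i).TimerDone t) := by
  have hm : ∀ j, ∃ m : Msg, j ∈ A → m.miniRound = ρ ∧
      ∀ i, (j, i, m) ∈ (e.cfg k).sent ∧ (j, i, m) ∉ (e.cfg k₀).sent := fun j => by
    by_cases hj : j ∈ A
    · obtain ⟨m, hm⟩ := (hAm j hj).2
      exact ⟨m, fun _ => hm⟩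
    · exact ⟨.est 0 true, fun h => absurd h hj⟩
  choose m hm using hm
  refine (h.deliver_all hk A m fun j hj => ⟨(hAm j hj).1, (hm j hj).2⟩).imp
    fun k' _ hq i hi k'' hk'' hlt => .inr ⟨ρ, hlt, hA.trans ?_⟩
  exact LocalState.card_le_numSenders A fun j hj =>
    ⟨m j, (hm j hj).1, (grows hi hk'').rcv (hq i hi j hj)⟩

/-- If some correct process has set its first timer of the next round, then the correct processes
that are still in round `r` get through it in bounded time. -/
theorem round_catchUp (h : e.Paced clk D k₀ R) (ht : 3 * t < n) (hf : faulty.card ≤ t) {r : ℕ}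
    (hr : R ≤ r) {k : ℕ} (hk : k₀ ≤ k) (hpos : ∀ i ∉ faulty, 5 * r ≤ (e.st k i).pos)
    {p : Fin n} (hp : p ∉ faulty) (hahead : 5 * (r + 1) + 1 ≤ (e.st k p).pos) :
    Within clk D 17 k (fun k' => ∀ i ∉ faulty, 5 * (r + 1) ≤ (e.st k' i).pos) := by
  obtain ⟨A, hA, hA'⟩ := est_senders ht hf (by omega) hp hahead
  refine (h.catchUp hk hA (ρ := 2 * (r + 1)) fun j hj => ?_).trans (d' := 16)
    fun k1 hk1 hq => h.round_progress ht hf hr (hk.trans hk1)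
      (fun i hi => (hpos i hi).trans (pos_mono hi hk1)) fun i hi k' hk' q hq' hpq =>
        .of_self h.nonneg (.inr (hq i hi k' hk' ?_))
  · obtain ⟨hjf, v, hv⟩ := hA' j hj
    exact ⟨hjf, _, rfl, fun i => ⟨hv i, (h.not_sent hf (by omega) hjf i).1 v⟩⟩
  · exact LocalState.miniRound_le (e.idle_round hi k') (by omega) (by omega)

theorem start_le (h : e.Paced clk D k₀ R) {k : ℕ} {i : Fin n} (hi : i ∉ faulty)
    (hp : 5 * R ≤ (e.st k i).pos) : k₀ ≤ k := by
  by_contra hlt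
  have h1 := (grows (e := e) hi (show k ≤ k₀ by omega)).round_le
  have h2 := h.round_lt i hi
  have h3 := LocalState.round_le_of_pos hp
  omega

end Paced

/-! ### A round in which a correct coordinator imposes its value -/

/-- From the stabilization on, message delays and processing times are bounded by one unit `D` of
real time, and timers do not expire early.  No bound on how long a timer may run is needed. -/
theorem exists_paced (hsync : e.EventuallySynchronous) : ∃ τ c D : ℝ, ∃ k₀ R : ℕ, 0 < c ∧ 0 < D ∧
    e.SlowTimers τ c ∧ τ ≤ e.time k₀ ∧ e.Paced e.time D k₀ R := by
  obtain ⟨τ, δ, θ, c, hδ, hθ, hc, hmsg, hact, hslow, _⟩ := hsync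
  obtain ⟨k₀, hk₀⟩ := (e.time_unbounded.eventually_ge_atTop τ).exists
  refine ⟨τ, c, δ + θ + 1, k₀, (Finset.univ.sup fun i => (e.st k₀ i).round) + 1, by linarith,
    by linarith, hslow, hk₀, ⟨by linarith, by omega, fun i _ => ?_, ?_, ?_⟩⟩
  · exact Nat.lt_succ_of_le (Finset.le_sup (f := fun i => (e.st k₀ i).round) (Finset.mem_univ i))
  · intro i hi j hj m k hk hn hs
    -- the step in which the message was sent
    obtain ⟨k1, hk1, hk1', h1, h2⟩ : ∃ k1 ≥ k₀, k1 + 1 ≤ k ∧ (i, j, m) ∉ (e.cfg k1).sent ∧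
        (i, j, m) ∈ (e.cfg (k1 + 1)).sent := by
      induction hk with
      | refl => exact absurd hs hn
      | @step k hk ih =>
        by_cases h : (i, j, m) ∈ (e.cfg k).sent
        · obtain ⟨k1, h1, h2, h3⟩ := ih h
          exact ⟨k1, h1, by omega, h3⟩
        · exact ⟨k, hk, le_rfl, h, hs⟩
    obtain ⟨k', hk', hr⟩ := hmsg i hi j hj m k1 h1 h2
      (hk₀.trans (e.time_mono (show k₀ ≤ k1 + 1 by omega)))
    refine ⟨max k k', le_max_left _ _, ?_, (grows hj (le_max_right k k')).rcv hr⟩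
    have h3 := e.time_mono hk1'
    rw [e.time_mono.map_max, max_le_iff]
    constructor <;> push_cast <;> linarith
  · intro i hi a ha k hk he
    obtain ⟨k', hk', h1, h2⟩ := hact i hi a ha k (hk₀.trans (e.time_mono hk)) he
    exact ⟨k', hk', by push_cast; linarith, h2⟩

/-- If `G` grows by ever larger steps, and `F` advances to at most `E` after the larger one of its
last value and the current value of `G`, then `F` eventually lags behind `G` by at most `E`. -/
theorem lag_bounded {F G : ℕ → ℝ} {c E : ℝ} {R : ℕ} (hc : 0 < c) (hE : 0 < E)
    (hG : ∀ r ≥ R, G r + r / c ≤ G (r + 1))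
    (hF : ∀ r ≥ R, F (r + 1) ≤ max (F r) (G (r + 1)) + E) :
    ∃ R', ∀ r ≥ R', F r ≤ G r + E := by
  obtain ⟨N, hN⟩ := exists_nat_ge (2 * E * c)
  set S := max R N
  have hstep : ∀ r ≥ S, 2 * E ≤ G (r + 1) - G r := fun r hr => by
    have h1 := hG r ((le_max_left _ _).trans hr)
    have h2 : (N : ℝ) ≤ r := by exact_mod_cast (le_max_right R N).trans hr
    have h3 : 2 * E ≤ r / c := by rw [le_div_iff₀ hc]; linarith
    linarith
  have hlag : ∀ m : ℕ, F (S + m) - G (S + m) ≤ max E (F S - G S - m * E) := by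
    intro m
    induction m with
    | zero => simp
    | succ m ih =>
      have h1 := hstep (S + m) (by omega)
      have h2 := hF (S + m) ((le_max_left _ _).trans (Nat.le_add_right S m))
      rw [add_assoc] at h1 h2
      push_cast
      rcases max_cases (F (S + m)) (G (S + (m + 1))) with ⟨h, _⟩ | ⟨h, _⟩ <;> rw [h] at h2
      · rw [le_max_iff] at ih ⊢
        rcases ih with ih | ih
        · left; linarith
        · right; linarith
      · exact le_max_of_le_left (by linarith)
  obtain ⟨M, hM⟩ := exists_nat_ge ((F S - G S) / E)
  refine ⟨S + M, fun r hr => ?_⟩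
  obtain ⟨m, rfl⟩ := Nat.exists_eq_add_of_le hr
  have h1 := hlag (M + m)
  have h2 : F S - G S ≤ M * E := by rwa [div_le_iff₀ hE] at hM
  have h3 : (0 : ℝ) ≤ m * E := by positivity
  rw [← add_assoc, max_eq_left (by push_cast; linarith)] at h1
  linarith

namespace Paced

variable {τ c D : ℝ} {k₀ R : ℕ}

/-- Eventually, all correct processes enter a round at most a bounded time after the first one of
them has set its timer in this round. -/
theorem lag (h : e.Paced e.time D k₀ R) (ht : 3 * t < n) (hf : faulty.card ≤ t) (hc : 0 < c)
    (hD : 0 < D) (hslow : e.SlowTimers τ c) (hτ : τ ≤ e.time k₀) :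
    ∃ R', ∀ r ≥ R', e.time (e.allAt (5 * r)) ≤ e.time (e.firstAt (5 * r + 1)) + 17 * D := by
  have hne := exists_correct (n := n) ht hf
  have hall := exists_all_pos ht hf hc hslow
  have h1R := h.one_le
  have hfirst : ∀ p ≥ 5 * R, k₀ ≤ e.firstAt p := fun p hp => by
    obtain ⟨i, hi, hip⟩ := firstAt_spec hne (hall p)
    exact h.start_le hi (hp.trans hip)
  refine lag_bounded (F := fun r => e.time (e.allAt (5 * r)))
    (G := fun r => e.time (e.firstAt (5 * r + 1))) (R := R) hc (by positivity) (fun r hr => ?_)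
    fun r hr => ?_
  · refine (first_timer hf hne hc hslow hall (by omega)
      (hτ.trans (e.time_mono (hfirst _ (by omega))))).trans (e.time_mono ?_)
    exact firstAt_mono hne (by omega) (hall _)
  · rw [← e.time_mono.map_max]
    set k := max (e.allAt (5 * r)) (e.firstAt (5 * (r + 1) + 1))
    obtain ⟨p, hp, hpp⟩ := firstAt_spec hne (hall (5 * (r + 1) + 1))
    obtain ⟨k', hk', htime, hpos⟩ := h.round_catchUp ht hf hr (k := k)
      ((hfirst _ (by omega)).trans (le_max_right _ _))
      (fun i hi => (allAt_spec (hall _) i hi).trans (pos_mono hi (le_max_left _ _))) hp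
      (hpp.trans (pos_mono hp (le_max_right _ _)))
    refine le_trans (e.time_mono (Nat.sInf_le hpos)) ?_
    exact_mod_cast htime

/-- In a round with a correct coordinator that all correct processes enter early enough before the
first one of them stops waiting for the value of the coordinator, this value becomes the
estimate of all correct processes. -/
theorem unanimous_of_coord (h : e.Paced e.time D k₀ R) (ht : 3 * t < n) (hf : faulty.card ≤ t)
    (hc : 0 < c) (hD : 0 < D) (hslow : e.SlowTimers τ c) (hτ : τ ≤ e.time k₀) {r : ℕ} (hr : R ≤ r)
    (hlag : e.time (e.allAt (5 * r)) ≤ e.time (e.firstAt (5 * r + 1)) + 17 * D)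
    (hlong : 40 * D ≤ r / c) {q : Fin n} (hq : q ∉ faulty) (hqr : IsCoord q r) :
    ∃ w, e.Unanimous (r + 1) w := by
  have hne : ∃ i, i ∉ faulty := ⟨q, hq⟩
  have hall := exists_all_pos ht hf hc hslow
  have h1R := h.one_le
  have hfirst : ∀ p ≥ 5 * R, k₀ ≤ e.firstAt p := fun p hp => by
    obtain ⟨i, hi, hip⟩ := firstAt_spec hne (hall p)
    exact h.start_le hi (hp.trans hip)
  have hpos0 := allAt_spec (hall (5 * r))
  have hk0 : k₀ ≤ e.allAt (5 * r) := h.start_le hq ((by omega : 5 * R ≤ 5 * r).trans (hpos0 q hq))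
  -- in configuration `k3` all correct processes have the value `w` of the coordinator
  obtain ⟨k2, hk2, htime2, hpos2⟩ := h.to_m05 ht hf hr hk0 hpos0
  obtain ⟨w, hw, k3, hk3, htime3, hpos3⟩ :=
    h.coord_value ht hf hr (hk0.trans hk2) (fun i hi => (hpos2 i hi).1) hq hqr
  have hleave1 := first_timer hf hne hc hslow hall (r := r) (by omega)
    (hτ.trans (e.time_mono (hfirst _ (by omega))))
  push_cast at htime2 htime3
  have hk3' : k3 < e.firstAt (5 * r + 3) := by
    by_contra hle
    have := e.time_mono (not_lt.1 hle)
    linarith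
  have haux : ∀ i ∉ faulty, ∀ j k A, (i, j, Msg.aux r A) ∈ (e.cfg k).sent → A = {w} := by
    intro i hi j k A hA
    obtain ⟨k', _, h1, h2, _, h3, _⟩ := exists_aux_step hi hA
    have hrd := (LocalState.pos_m05 h1).2
    have hk' : k3 ≤ k' := by have := firstAt_le (e := e) hi h2.ge; omega
    rcases h3 with ⟨w', ⟨⟨j', hj', hm⟩, _⟩, rfl⟩ | ⟨h3, _⟩
    · have : j' = q := Fin.ext ((hrd ▸ hj' : IsCoord j' r).trans hqr.symm)
      subst this
      rw [hrd] at hm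
      rw [coord_unique hq (sent_of_rcv hi hm) (hw i)]
    · refine absurd ⟨⟨q, ?_, ?_⟩, ?_⟩ (h3 w)
      · rw [hrd]; exact hqr
      · rw [hrd]; exact (grows hi hk').rcv (hpos3 i hi).1
      · rw [hrd]; exact (grows hi hk').bin _ _ (hpos3 i hi).2
  -- in configuration `k6` all correct processes have each other's `AUX` messages
  obtain ⟨p, hp, hpp⟩ := firstAt_spec hne (hall (5 * r + 4))
  set k4 := e.firstAt (5 * r + 4)
  have hk4 : k3 ≤ k4 :=
    hk3'.le.trans (firstAt_mono hne (show 5 * r + 3 ≤ 5 * r + 4 by omega) (hall _))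
  have hk04 : k₀ ≤ k4 := hfirst _ (by omega)
  obtain ⟨A, hA, hA'⟩ := aux_senders ht hf (by omega) hp hpp
  obtain ⟨k5, hk5, htime5, hcatch⟩ := h.catchUp hk04 hA (ρ := 2 * r + 1) fun j hj => by
    obtain ⟨hjf, S, hS⟩ := hA' j hj
    exact ⟨hjf, _, rfl, fun i => ⟨hS i, (h.not_sent hf hr hjf i).2.2 S⟩⟩
  have hk25 : k2 ≤ k5 := hk3.trans (hk4.trans hk5)
  obtain ⟨k5', hk5', htime5', hpos5⟩ := h.to_new4 (r := r) (hk04.trans hk5)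
    (fun i hi => ⟨(hpos2 i hi).1.trans (pos_mono hi hk25),
      bin_ne_nil_mono hi hk25 (hpos2 i hi).2⟩) fun i hi k' hk' hpk => by
    refine .of_self h.nonneg (.inr (hcatch i hi k' hk' ?_))
    obtain ⟨hpc, hrd⟩ := LocalState.pos_m05 hpk
    rw [LocalState.miniRound_m05 hpc, hrd]
    omega
  obtain ⟨b, hb, k6, hk6, htime6, hrcv⟩ :=
    h.aux_received hf hr (hk04.trans (hk5.trans hk5')) hpos5
  have hleave2 := second_timer hf hne hc hslow hall (r := r) (by omega)
    (hτ.trans (e.time_mono hk04))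
  push_cast at htime5 htime5' htime6
  have hk6' : k6 < e.firstAt (5 * (r + 1)) := by
    by_contra hle
    have := e.time_mono (not_lt.1 hle)
    linarith
  refine ⟨w, fun i hi k hk => ?_⟩
  obtain ⟨k', _, h1, h2, V, hV, h3⟩ := exists_m07_step hi (by omega) hk.ge
  obtain ⟨hpc, hrd⟩ := LocalState.pos_m07 h1
  have hk' : k6 ≤ k' := by have := firstAt_le (e := e) hi h2; omega
  have hauxi : (e.st k' i).aux = {w} := by
    have := aux_sent hi (k := k') (.inr hpc) i
    rw [hrd] at this
    exact haux i hi _ _ _ this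
  -- `aux` itself qualifies as `values`, because all correct processes have sent the same set
  have hVw : V = {w} := by
    rw [← hauxi]
    refine hV.2 ?_
    obtain ⟨Q, hQ, hQc⟩ := Finset.exists_subset_card_eq (card_correct (n := n) hf)
    rw [hauxi]
    refine ⟨by simp, ?_, Q, fun _ => {w}, hQc, fun j hj => ?_, ?_⟩
    · simp only [Finset.singleton_subset_iff, List.mem_toFinset, hrd]
      exact (grows hi (hk4.trans (hk5.trans (hk5'.trans (hk6.trans hk'))))).bin _ _ (hpos3 i hi).2
    · have hjf := Finset.mem_compl.1 (hQ hj)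
      have := hrcv i hi j (hQ hj)
      rw [haux j hjf i _ _ (hb j hjf i)] at this
      rw [hrd]
      exact (grows hi hk').rcv this
    · have hQne : Q.Nonempty := Finset.card_pos.1 (by omega)
      ext v
      simp [Finset.mem_biUnion, hQne.exists_mem]
  subst hVw
  rcases h3 with ⟨v, hv, h3, _⟩ | ⟨hv, _⟩
  · rw [h3 hk]
    exact (Finset.singleton_inj.1 hv).symm
  · exact absurd hv (by clear * -; revert w; decide)

end Paced

theorem termination_holds (ht : 3 * t < n) (hf : faulty.card ≤ t)
    (hsync : e.EventuallySynchronous) : e.Termination := by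
  obtain ⟨τ, c, D, k₀, R, hc, hD, hslow, hτ, h⟩ := exists_paced hsync
  obtain ⟨q, hq⟩ := exists_correct (n := n) ht hf
  obtain ⟨R', hR'⟩ := h.lag ht hf hc hD hslow hτ
  obtain ⟨N, hN⟩ := exists_nat_ge (40 * D * c)
  set M := max (max R R') N
  have hM : M ≤ n * M := Nat.le_mul_of_pos_left M (by omega)
  have hMR : R ≤ M ∧ R' ≤ M ∧ N ≤ M := by simp [M]
  have hlong : 40 * D ≤ ((n * M + q + 1 : ℕ) : ℝ) / c := by
    rw [le_div_iff₀ hc]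
    exact hN.trans (by exact_mod_cast (by omega : N ≤ n * M + q + 1))
  obtain ⟨w, hw⟩ := h.unanimous_of_coord ht hf hc hD hslow hτ (r := n * M + q + 1) (by omega)
    (hR' _ (by omega)) hlong hq (by simp [IsCoord, Nat.mod_eq_of_lt q.isLt])
  refine termination_of_unanimous hf (fun i hi r => ?_) (by omega) hw
  obtain ⟨k, hk⟩ := exists_all_pos ht hf hc hslow (5 * r)
  exact ⟨k, LocalState.round_le_of_pos (hk i hi)⟩

end Execution

end BBC

theorem mainTheorem1 (n t : ℕ) (ht : 3 * t < n) (sr : BBC.StartRule) (gr : BBC.GrowthRule)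
    (faulty : Finset (Fin n)) (hfaulty : faulty.card ≤ t) (x : Fin n → Bool)
    (e : BBC.Execution n t sr gr faulty x) (hsync : e.EventuallySynchronous) :
    e.Validity ∧ e.Agreement ∧ e.Termination :=
  ⟨e.validity_holds hfaulty, e.agreement_holds ht hfaulty, e.termination_holds ht hfaulty hsync⟩
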